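/- **Theorem (correctness of Shapley-PC).** Let $V$ be a finite set, let $P$ be a joint probability distribution of random variables $(X_v)_{v\in V}$ with values in standard Borel spaces, and let $G$ be a DAG on $V$ such that $P$ is Markov and faithful to $G$: for all distinct $i,j\in V$ and $S\subseteq V\setminus\{i,j\}$, $X_i$ and $X_j$ are conditionally independent given $(X_s)_{s\in S}$ if and only if $S$ d-separates $i$ and $j$ in $G$. Let $I$ be a perfect conditional independence test for $P$, i.e. for all such $i,j,S$, $I(i,j\mid S)=1$ if $X_i$ and $X_j$ are conditionally independent given $(X_s)_{s\in S}$ and $I(i,j\mid S)=0$ otherwise, and let $\alpha\in(0,1]$ (independence is accepted when $I\ge\alpha$). Then Shapley-PC, run with $I$ and $\alpha$, terminates and outputs exactly the CPDAG of $G$, whatever the order in which it processes unshielded triples and applies Meek's rules. Here Shapley-PC consists of three steps. 1. *PC-stable adjacency search.* Start with the complete graph $C$ on $V$. For $\ell=0,1,2,\dots,|V|-1$, remove every edge $i-k$ for which there is $S$ with $|S|=\ell$, $S\subseteq \mathrm{adj}(C,i)\setminus\{k\}$ and $I(i,k\mid S)\ge\alpha$, or $S\subseteq \mathrm{adj}(C,k)\setminus\{i\}$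 and $I(k,i\mid S)\ge\alpha$, where the adjacency sets are those at the start of level $\ell$. Let $C$ denote the final graph. 2. *Orientation of v-structures.* For nonadjacent $i\ne k$ in $C$ and $c\in A:=\mathrm{adj}(C,i)\cup\mathrm{adj}(C,k)$, let $n=|A|$ and define the Shapley independence value $$\phi_I(c,\{i,k\})=\sum_{S}\frac{|S|!\,(n-|S|-1)!}{n!}\,\bigl[I(i,k\mid S\cup\{c\})-I(i,k\mid S)\bigr],$$ the sum being over all sets $S$ with $S\subseteq\mathrm{adj}(C,i)\setminus\{c\}$ or $S\subseteq\mathrm{adj}(C,k)\setminus\{c\}$. Start with all edges of $C$ undirected, and go through the unshielded triples $i-j-k$ of $C$ ($i\ne k$, $j$ adjacent to both, $i,k$ nonadjacent). If $\phi_I(j,\{i,k\})$ is the most negative value, i.e. $\phi_I(j,\{i,k\})<0$ and $\phi_I(j,\{i,k\})=\min_{c\in A}\phi_I(c,\{i,k\})$, and if the triple is not yet fully directed and no bidirected edge or directed cycle would arise, orient it as $i\to j\leftarrow k$. 3. *Meek's rules for patterns.* As long as one of the following applies, orient an undirected edge $a-b$ as $a\to b$: (R1) there is $c\to a$ with $c,b$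 nonadjacent; (R2) there is $c$ with $a\to c\to b$; (R3) there are distinct nonadjacent $c,d$ with $a-c$, $a-d$, $c\to b$, $d\to b$. The CPDAG of $G$ is the partially directed graph with a directed edge $a\to b$ if every DAG in the Markov equivalence class of $G$ (all DAGs on $V$ with the same d-separations as $G$) contains $a\to b$, and an undirected edge $a-b$ if both directions appear in DAGs of the class. -/

import Mathlib

open MeasureTheory ProbabilityTheory

noncomputable section

namespace ShapleyPC

/-! ### Directed acyclic graphs, d-separation, Markov equivalence -/

/-- A directed graph is acyclic if no nonempty directed path returns to its starting vertex. -/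
def IsDAG {V : Type*} (G : Digraph V) : Prop :=
  ∀ v, ¬ Relation.TransGen G.Adj v v

/-- The skeleton of a directed graph: forget all directions. -/
abbrev skel {V : Type*} (G : Digraph V) : SimpleGraph V :=
  G.toSimpleGraphInclusive

/-- The consecutive vertices `a, m, b` of a path do not block it, given the set `S`: if `m` is a
collider (`a → m ← b`), then `m` or one of its descendants lies in `S`; otherwise `m ∉ S`. -/
def OpenAt {V : Type*} (G : Digraph V) (S : Finset V) (a m b : V) : Prop :=
  ((G.Adj a m ∧ G.Adj b m) → ∃ d ∈ S, Relation.ReflTransGen G.Adj m d) ∧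
    (¬ (G.Adj a m ∧ G.Adj b m) → m ∉ S)

/-- `S` d-separates `i` and `j` in `G`: every path between them in the skeleton (directions are
ignored, vertices are not repeated) is blocked by `S` at some inner vertex. -/
def DSep {V : Type*} (G : Digraph V) (i j : V) (S : Finset V) : Prop :=
  ∀ p : (skel G).Walk i j, p.IsPath →
    ¬ ∀ a m b : V, [a, m, b] <:+: p.support → OpenAt G S a m b

/-- Two directed graphs are Markov equivalent if they have the same d-separations. -/
def MarkovEquiv {V : Type*} (G G' : Digraph V) : Prop :=
  ∀ (i j : V) (S : Finset V), i ≠ j → i ∉ S → j ∉ S → (DSep G i j S ↔ DSep G' i j S)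

/-- The Markov equivalence class of `G`. -/
def MEC {V : Type*} (G : Digraph V) : Set (Digraph V) :=
  {G' | IsDAG G' ∧ MarkovEquiv G G'}

/-! ### Partially directed graphs -/

/-- A partially directed graph: directed edges `dir a b` (`a → b`), undirected ones
`undir a b` (`a - b`). -/
@[ext]
structure PDAG (V : Type*) where
  dir : V → V → Prop
  undir : V → V → Prop
  undir_symm : ∀ a b, undir a b → undir b a

/-- The CPDAG of the DAG `G`: `a → b` if every DAG of the Markov equivalence class has this edge;
`a - b` if both directions appear in DAGs of the class. -/
def cpdag {V : Type*} (G : Digraph V) : PDAG V where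
  dir a b := ∀ G' ∈ MEC G, G'.Adj a b
  undir a b := (∃ G' ∈ MEC G, G'.Adj a b) ∧ (∃ G' ∈ MEC G, G'.Adj b a)
  undir_symm _ _ h := ⟨h.2, h.1⟩

namespace PDAG

/-- Adjacency in a partially directed graph. -/
def Adj {V : Type*} (H : PDAG V) (a b : V) : Prop :=
  H.dir a b ∨ H.dir b a ∨ H.undir a b

/-- The graph with all edges undirected. -/
def ofSkeleton {V : Type*} (C : SimpleGraph V) : PDAG V where
  dir _ _ := False
  undir := C.Adj
  undir_symm _ _ h := h.symm

/-- Orient the edge between `a` and `b` as `a → b`. -/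
def orientEdge {V : Type*} (H : PDAG V) (a b : V) : PDAG V where
  dir x y := H.dir x y ∨ (x = a ∧ y = b)
  undir x y := H.undir x y ∧ ¬ (x = a ∧ y = b) ∧ ¬ (x = b ∧ y = a)
  undir_symm _ _ h :=
    ⟨H.undir_symm _ _ h.1, fun e => h.2.2 ⟨e.2, e.1⟩, fun e => h.2.1 ⟨e.2, e.1⟩⟩

/-- Orient the triple `i, j, k` as the v-structure `i → j ← k`. -/
def orientV {V : Type*} (H : PDAG V) (i j k : V) : PDAG V :=
  (H.orientEdge i j).orientEdge k j

/-- There is no directed cycle. -/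
def NoDirCycle {V : Type*} (H : PDAG V) : Prop :=
  ∀ v, ¬ Relation.TransGen H.dir v v

end PDAG

/-! ### Conditional independence -/

/-- For a joint distribution `P` of variables indexed by `V`: variables `i` and `j` are
conditionally independent given the variables in `S`. -/
def CondInd {V : Type*} [Fintype V] {E : V → Type*} [∀ v, MeasurableSpace (E v)]
    [∀ v, StandardBorelSpace (E v)] (P : Measure (∀ v, E v)) [IsProbabilityMeasure P]
    (i j : V) (S : Finset V) : Prop :=
  CondIndepFun (MeasurableSpace.comap (fun (x : ∀ v, E v) (s : S) => x s) inferInstance)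
    (Measurable.comap_le (measurable_pi_lambda _ fun s => measurable_pi_apply (s : V)))
    (fun x => x i) (fun x => x j) P

/-- `P` is (Markov and) faithful to `G`: its conditional independences between two variables are
exactly the d-separations of `G`. -/
def Faithful {V : Type*} [Fintype V] {E : V → Type*} [∀ v, MeasurableSpace (E v)]
    [∀ v, StandardBorelSpace (E v)] (P : Measure (∀ v, E v)) [IsProbabilityMeasure P]
    (G : Digraph V) : Prop :=
  ∀ (i j : V) (S : Finset V), i ≠ j → i ∉ S → j ∉ S → (CondInd P i j S ↔ DSep G i j S)

/-- `I` is a perfect conditional independence test for `P`: its value (the observed significance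
level) is `1` if `i` and `j` are independent given `S`, and `0` otherwise. -/
def IsPerfectCIT {V : Type*} [Fintype V] {E : V → Type*} [∀ v, MeasurableSpace (E v)]
    [∀ v, StandardBorelSpace (E v)] (P : Measure (∀ v, E v)) [IsProbabilityMeasure P]
    (I : V → V → Finset V → ℝ) : Prop :=
  ∀ (i j : V) (S : Finset V), i ≠ j → i ∉ S → j ∉ S →
    (CondInd P i j S → I i j S = 1) ∧ (¬ CondInd P i j S → I i j S = 0)

/-! ### Step 1: PC-stable adjacency search -/

/-- Some test with a conditioning set of size `l` inside `adj(C, i) \ {k}` accepts independence of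
`i` and `k` at significance level `α`. -/
def Separated {V : Type*} (I : V → V → Finset V → ℝ) (α : ℝ) (C : SimpleGraph V) (l : ℕ)
    (i k : V) : Prop :=
  ∃ S : Finset V, S.card = l ∧ (∀ s ∈ S, C.Adj i s ∧ s ≠ k) ∧ α ≤ I i k S

/-- The graph of PC-stable before level `l`. It starts from the complete graph. At level `l`, the
conditioning sets have size `l` and are taken from the adjacency sets as they are at the start of
the level; an edge `i - k` is removed if one of the ordered pairs `(i, k)`, `(k, i)` is found to be
separated. -/
def pcStableLevel {V : Type*} (I : V → V → Finset V → ℝ) (α : ℝ) : ℕ → SimpleGraph V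
  | 0 => ⊤
  | l + 1 =>
    { Adj := fun i k => (pcStableLevel I α l).Adj i k ∧
        ¬ Separated I α (pcStableLevel I α l) l i k ∧
        ¬ Separated I α (pcStableLevel I α l) l k i
      symm := ⟨fun _ _ h => ⟨h.1.symm, h.2.2, h.2.1⟩⟩
      loopless := ⟨fun _ h => h.1.ne rfl⟩ }

/-- The skeleton found by PC-stable, levels `0, 1, …, |V| - 1`. (No conditioning set is left from
the level on at which all adjacency sets are too small, so stopping there gives the same graph.) -/
def pcStable {V : Type*} [Fintype V] (I : V → V → Finset V → ℝ) (α : ℝ) : SimpleGraph V :=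
  pcStableLevel I α (Fintype.card V)

/-! ### Step 2: orienting v-structures by Shapley independence values -/

/-- `i - j - k` is an unshielded triple of `C`. -/
def IsUT {V : Type*} (C : SimpleGraph V) (i j k : V) : Prop :=
  i ≠ k ∧ C.Adj i j ∧ C.Adj j k ∧ ¬ C.Adj i k

open Classical in
/-- The conditioning sets: all `S` with `S ⊆ adj(C, i) \ {j}` or `S ⊆ adj(C, k) \ {j}`. -/
def condSets {V : Type*} [Fintype V] (C : SimpleGraph V) (i j k : V) : Finset (Finset V) :=
  Finset.univ.filter fun S =>
    (∀ s ∈ S, C.Adj i s ∧ s ≠ j) ∨ (∀ s ∈ S, C.Adj k s ∧ s ≠ j)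

open Classical in
/-- The number of players: all variables adjacent to `i` or to `k`. -/
def numPlayers {V : Type*} [Fintype V] (C : SimpleGraph V) (i k : V) : ℕ :=
  (Finset.univ.filter fun v => C.Adj i v ∨ C.Adj k v).card

/-- The Shapley weight `|S|! (n - |S| - 1)! / n!`, with `s = |S|`. -/
def shapleyWeight (n s : ℕ) : ℝ :=
  ((s.factorial : ℝ) * ((n - s - 1).factorial : ℝ)) / (n.factorial : ℝ)

open Classical in
/-- The Shapley independence value of the variable `j` for the pair `i, k`. -/
def siv {V : Type*} [Fintype V] (I : V → V → Finset V → ℝ) (C : SimpleGraph V) (j i k : V) : ℝ :=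
  ∑ S ∈ condSets C i j k,
    shapleyWeight (numPlayers C i k) S.card * (I i k (insert j S) - I i k S)

/-- The decision rule: `j` has the most negative value, that is, its value is negative and is the
least among those of all variables adjacent to `i` or to `k`. -/
def DeclaredCollider {V : Type*} [Fintype V] (I : V → V → Finset V → ℝ) (C : SimpleGraph V)
    (i j k : V) : Prop :=
  IsLeast ((fun c => siv I C c i k) '' {c | C.Adj i c ∨ C.Adj k c}) (siv I C j i k) ∧
    siv I C j i k < 0

/-- The conditions under which a declared v-structure is really oriented: the triple is not fully
directed yet, no bidirected edge and no directed cycle would arise. -/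
def Orientable {V : Type*} (H : PDAG V) (i j k : V) : Prop :=
  ¬ ((H.dir i j ∨ H.dir j i) ∧ (H.dir k j ∨ H.dir j k)) ∧ ¬ H.dir j i ∧ ¬ H.dir j k ∧
    (H.orientV i j k).NoDirCycle

open Classical in
/-- The body of the loop over unshielded triples. -/
def vStep {V : Type*} [Fintype V] (I : V → V → Finset V → ℝ) (C : SimpleGraph V) (H : PDAG V)
    (t : V × V × V) : PDAG V :=
  if DeclaredCollider I C t.1 t.2.1 t.2.2 ∧ Orientable H t.1 t.2.1 t.2.2 then
    H.orientV t.1 t.2.1 t.2.2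
  else H

/-- `L` lists the unshielded triples of `C`, where `i - j - k` and `k - j - i` are the same. -/
def ListsUTs {V : Type*} (C : SimpleGraph V) (L : List (V × V × V)) : Prop :=
  (∀ t ∈ L, IsUT C t.1 t.2.1 t.2.2) ∧
    ∀ i j k, IsUT C i j k → (i, j, k) ∈ L ∨ (k, j, i) ∈ L

/-- Step 2: process the unshielded triples in the order of the list `L`. -/
def orientVStructures {V : Type*} [Fintype V] (I : V → V → Finset V → ℝ) (C : SimpleGraph V)
    (L : List (V × V × V)) : PDAG V :=
  L.foldl (vStep I C) (PDAG.ofSkeleton C)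

/-! ### Step 3: Meek's rules for patterns -/

/-- One of Meek's rules for patterns directs the undirected edge `a - b` as `a → b`. -/
def MeekApplies {V : Type*} (H : PDAG V) (a b : V) : Prop :=
  H.undir a b ∧
    ((∃ c, H.dir c a ∧ ¬ H.Adj c b) ∨
      (∃ c, H.dir a c ∧ H.dir c b) ∨
      (∃ c d, c ≠ d ∧ H.undir a c ∧ H.undir a d ∧ H.dir c b ∧ H.dir d b ∧ ¬ H.Adj c d))

/-- One application of a rule. -/
def MeekStep {V : Type*} (H H' : PDAG V) : Prop :=
  ∃ a b, MeekApplies H a b ∧ H' = H.orientEdge a b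

/-- `H'` results from `H` by applying the rules, in some order, until none applies. -/
def MeekResult {V : Type*} (H H' : PDAG V) : Prop :=
  Relation.ReflTransGen MeekStep H H' ∧ ∀ H'', ¬ MeekStep H' H''

/-! ### The algorithm -/

/-- The partially directed graph after Steps 1 and 2, with the unshielded triples processed in the
order of `L`. -/
def afterStep2 {V : Type*} [Fintype V] (I : V → V → Finset V → ℝ) (α : ℝ)
    (L : List (V × V × V)) : PDAG V :=
  orientVStructures I (pcStable I α) L

/-- `H` is an output of Shapley-PC with the test `I`, significance level `α` and the order `L`. -/
def IsOutput {V : Type*} [Fintype V] (I : V → V → Finset V → ℝ) (α : ℝ)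
    (L : List (V × V × V)) (H : PDAG V) : Prop :=
  MeekResult (afterStep2 I α L) H

end ShapleyPC

end

/-!
The proof separates three matters: d-separation, the class of graphs with the d-separations of `G`,
and the algorithm.

*d-separation.* Cutting loops out of an open trail leaves an open trail (`Trail.cut`), so vertices
may be repeated, and d-separation can be decided by following a Bayes ball (`dSep_iff_ball`). If two
vertices are not adjacent, the parents of one of them separate them (`exists_dSep`). In an
unshielded triple, a collider lies in no separating set and a noncollider lies in all of them.

*The Markov equivalence class.* By the previous remarks, Markov equivalent acyclic graphs have the
same skeleton and v-structures. The converse (`SamePattern.markovEquiv`) is Chickering's argument: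
two graphs with the same skeleton and v-structures are connected by reversals of covered edges, and
such a reversal does not change where the Bayes ball can go (`Covered.ball`).

*Meek's rules.* They are sound for every graph with the skeleton and v-structures of `G`. When no
rule applies, an arrow `a → b` and an undirected edge `b - c` force `a → c`
(`MeekInv.dir_of_dir_of_undir`). Hence the undirected part is chordal, and directing it along a
perfect order gives an acyclic graph with the same v-structures. Such an order may start at any
vertex (`exists_perfect_order`, from Dirac's theorem on simplicial vertices), so both directions of
an undirected edge occur in the class, and the graph is the CPDAG (`MeekInv.eq_cpdag`).

*The algorithm.* With a perfect test, the adjacency search finds the skeleton (`pcStable_eq_skel`).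
For an unshielded triple `i - j - k`, a noncollider `j` has a nonnegative Shapley value. A collider
`j` has minus the total weight of all separating sets among the conditioning sets, and this is
negative and a lower bound for the values of all players (`declaredCollider_iff`). Thus exactly the
v-structures are oriented, whatever the order, and the rules complete them to the CPDAG.
-/

namespace ShapleyPC

/-! ### Ranks of acyclic graphs, v-structures -/

section Basics

variable {V : Type*} {G : Digraph V}

theorem IsDAG.of_rank (f : V → ℕ) (hf : ∀ a b, G.Adj a b → f a < f b) : IsDAG G := by
  have key : ∀ a b, Relation.TransGen G.Adj a b → f a < f b := by
    intro a b h
    induction h with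
    | single h => exact hf _ _ h
    | tail _ h ih => exact ih.trans (hf _ _ h)
  exact fun v h => lt_irrefl _ (key v v h)

/-- The rank of a vertex is the number of its proper ancestors. -/
theorem IsDAG.exists_rank [Finite V] (hG : IsDAG G) :
    ∃ f : V → ℕ, ∀ a b, G.Adj a b → f a < f b := by
  refine ⟨fun v => {u | Relation.TransGen G.Adj u v}.ncard, fun a b h => ?_⟩
  refine Set.ncard_lt_ncard ⟨fun u hu => Relation.TransGen.tail hu h, fun hsub => ?_⟩
    (Set.toFinite _)
  exact hG a (hsub (Relation.TransGen.single h))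

theorem IsDAG.ne (hG : IsDAG G) {a b : V} (h : G.Adj a b) : a ≠ b := by
  rintro rfl
  exact hG a (.single h)

theorem IsDAG.asymm (hG : IsDAG G) {a b : V} (h : G.Adj a b) : ¬ G.Adj b a :=
  fun h' => hG a (.tail (.single h) h')

theorem IsDAG.no_triangle (hG : IsDAG G) {a b c : V} (h : G.Adj a b) (h' : G.Adj b c) :
    ¬ G.Adj c a :=
  fun h'' => hG a (.tail (.tail (.single h) h') h'')

theorem IsDAG.skel_adj (hG : IsDAG G) {a b : V} :
    (skel G).Adj a b ↔ G.Adj a b ∨ G.Adj b a := by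
  rw [skel, Digraph.toSimpleGraphInclusive, SimpleGraph.fromRel_adj]
  exact ⟨fun h => h.2, fun h => ⟨h.elim hG.ne fun h => (hG.ne h).symm, h⟩⟩

/-- `a → b ← c` is an unshielded collider (a v-structure) of `G`. -/
def VStruct (G : Digraph V) (a b c : V) : Prop :=
  G.Adj a b ∧ G.Adj c b ∧ a ≠ c ∧ ¬ (skel G).Adj a c

theorem VStruct.symm {a b c : V} (h : VStruct G a b c) : VStruct G c b a :=
  ⟨h.2.1, h.1, h.2.2.1.symm, fun h' => h.2.2.2 h'.symm⟩

/-- Two directed graphs have the same pattern: the same skeleton and the same v-structures. -/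
structure SamePattern (G G' : Digraph V) : Prop where
  skel_adj : ∀ a b, (skel G).Adj a b ↔ (skel G').Adj a b
  vStruct : ∀ a b c, VStruct G a b c ↔ VStruct G' a b c

theorem SamePattern.symm {G G' : Digraph V} (h : SamePattern G G') : SamePattern G' G :=
  ⟨fun a b => (h.skel_adj a b).symm, fun a b c => (h.vStruct a b c).symm⟩

theorem SamePattern.trans {G G' G'' : Digraph V} (h : SamePattern G G') (h' : SamePattern G' G'') :
    SamePattern G G'' :=
  ⟨fun a b => (h.skel_adj a b).trans (h'.skel_adj a b),
    fun a b c => (h.vStruct a b c).trans (h'.vStruct a b c)⟩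

end Basics

/-! ### Open trails -/

section Trails

variable {V : Type*} {G : Digraph V} {S : Finset V}

theorem OpenAt.symm {a m b : V} (h : OpenAt G S a m b) : OpenAt G S b m a :=
  ⟨fun h' => h.1 h'.symm, fun h' => h.2 fun h'' => h' h''.symm⟩

/-- A list of vertices is an open trail given `S` if consecutive vertices are adjacent and no inner
vertex blocks it. Vertices may be repeated, in contrast to the paths of `DSep`. -/
def Trail (G : Digraph V) (S : Finset V) (l : List V) : Prop :=
  l.IsChain (skel G).Adj ∧ ∀ a m b : V, [a, m, b] <:+: l → OpenAt G S a m b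

theorem Trail.infix {l l' : List V} (h : Trail G S l) (hl : l' <:+: l) : Trail G S l' :=
  ⟨h.1.infix hl, fun a m b hab => h.2 a m b (hab.trans hl)⟩

theorem Trail.reverse {l : List V} (h : Trail G S l) : Trail G S l.reverse := by
  refine ⟨?_, fun a m b hab => ?_⟩
  · rw [List.isChain_reverse]
    exact h.1.imp fun _ _ h => h.symm
  · refine (h.2 b m a ?_).symm
    have := List.reverse_infix.2 hab
    simpa using this

theorem trail_singleton (v : V) : Trail G S [v] := by
  refine ⟨List.isChain_singleton _, fun a m b h => ?_⟩
  have := h.length_le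
  simp at this

theorem trail_pair {v w : V} : Trail G S [v, w] ↔ (skel G).Adj v w := by
  refine ⟨fun h => by simpa using h.1, fun hvw => ⟨by simpa using hvw, fun a m b h => ?_⟩⟩
  have := h.length_le
  simp at this

theorem trail_cons {a m b : V} {t : List V} :
    Trail G S (a :: m :: b :: t) ↔
      (skel G).Adj a m ∧ OpenAt G S a m b ∧ Trail G S (m :: b :: t) := by
  constructor
  · intro h
    exact ⟨h.1.rel, h.2 a m b ⟨[], t, by simp⟩, h.infix (List.suffix_cons _ _).isInfix⟩
  · rintro ⟨h1, h2, h3⟩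
    refine ⟨List.isChain_cons_cons.2 ⟨h1, h3.1⟩, fun x y z h => ?_⟩
    rcases List.infix_cons_iff.1 h with h | h
    · simp only [List.cons_prefix_cons] at h
      obtain ⟨rfl, rfl, rfl, _⟩ := h
      exact h2
    · exact h3.2 x y z h

/-- Two open trails that meet at `v` can be joined if `v` does not block the joint trail. -/
theorem Trail.glue {v : V} {C : List V} : ∀ {A : List V}, Trail G S (A ++ [v]) →
    Trail G S (v :: C) → (∀ a ∈ A.getLast?, ∀ b ∈ C.head?, OpenAt G S a v b) →
    Trail G S (A ++ v :: C)
  | [], _, h, _ => h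
  | [a], h, h', hj => by
    rcases C with _ | ⟨b, C⟩
    · exact h
    · exact trail_cons.2 ⟨trail_pair.1 h, hj a (by simp) b (by simp), h'⟩
  | a :: m :: [], h, h', hj => by
    have h0 := trail_cons.1 h
    exact trail_cons.2 ⟨h0.1, h0.2.1, Trail.glue (A := [m]) h0.2.2 h' (by simpa using hj)⟩
  | a :: m :: b :: A, h, h', hj => by
    have h0 := trail_cons.1 h
    exact trail_cons.2 ⟨h0.1, h0.2.1,
      Trail.glue (A := m :: b :: A) h0.2.2 h' (by simpa using hj)⟩

/-- An open trail that starts along a directed edge `v → c` runs along directed edges to its end or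
to a collider, which has a descendant in `S`. -/
theorem Trail.descent (hG : IsDAG G) {v : V} : ∀ {t : List V} {c : V}, Trail G S (v :: c :: t) →
    G.Adj v c → (∃ d ∈ S, Relation.TransGen G.Adj v d) ∨
      ∀ w ∈ (c :: t).getLast?, Relation.TransGen G.Adj v w := by
  intro t
  induction t generalizing v with
  | nil =>
    intro c _ h
    right
    simp only [List.getLast?_singleton, Option.mem_some_iff, forall_eq']
    exact .single h
  | cons e t ih =>
    intro c ht h
    obtain ⟨-, ho, ht'⟩ := trail_cons.1 ht
    by_cases hec : G.Adj e c
    · obtain ⟨d, hd, hcd⟩ := ho.1 ⟨h, hec⟩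
      exact .inl ⟨d, hd, .head' h hcd⟩
    · have hce : G.Adj c e :=
        (hG.skel_adj.1 ht'.1.rel).resolve_right hec
      rcases ih ht' hce with ⟨d, hd, hcd⟩ | hw
      · exact .inl ⟨d, hd, .head h hcd⟩
      · right
        intro w hw'
        rw [List.getLast?_cons_cons] at hw'
        exact .head h (hw w hw')

theorem exists_append_of_not_nodup {l : List V} (h : ¬ l.Nodup) :
    ∃ (v : V) (A B C : List V), l = A ++ v :: (B ++ v :: C) := by
  induction l with
  | nil => exact absurd List.nodup_nil h
  | cons a l ih =>
    by_cases ha : a ∈ l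
    · obtain ⟨B, C, rfl⟩ := List.append_of_mem ha
      exact ⟨a, [], B, C, rfl⟩
    · have : ¬ l.Nodup := fun h' => h (List.nodup_cons.2 ⟨ha, h'⟩)
      obtain ⟨v, A, B, C, rfl⟩ := ih this
      exact ⟨v, a :: A, B, C, rfl⟩

/-- An open trail that visits `v` twice remains open when the part between the two visits is cut
out. If `v` becomes a collider, then it was one before, or it has a descendant which was one. -/
theorem Trail.cut (hG : IsDAG G) {v : V} {A B C : List V}
    (h : Trail G S (A ++ v :: (B ++ v :: C))) : Trail G S (A ++ v :: C) := by
  refine Trail.glue (h.infix ⟨[], B ++ v :: C, by simp⟩) (h.infix ⟨A ++ v :: B, [], by simp⟩) ?_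
  intro a ha b hb
  obtain ⟨A, rfl⟩ : ∃ A', A = A' ++ [a] := List.getLast?_eq_some_iff.1 ha
  obtain ⟨C, rfl⟩ : ∃ C', C = b :: C' := by
    rcases C with _ | ⟨c, C⟩
    · simp at hb
    · simp only [List.head?_cons, Option.mem_some_iff] at hb
      exact ⟨C, by rw [hb]⟩
  rcases B with _ | ⟨c, B⟩
  · have := (h.infix (l' := [v, v]) ⟨A ++ [a], b :: C, by simp⟩).1.rel
    exact absurd this (SimpleGraph.irrefl _)
  · have hfirst : OpenAt G S a v c := h.2 _ _ _ ⟨A, B ++ v :: b :: C, by simp⟩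
    have hloop : Trail G S (v :: c :: (B ++ [v])) := h.infix ⟨A ++ [a], b :: C, by simp⟩
    obtain ⟨e, B', hB'⟩ : ∃ e B', c :: B = B' ++ [e] :=
      ⟨_, _, (List.dropLast_append_getLast (List.cons_ne_nil c B)).symm⟩
    have hlast : OpenAt G S e v b := by
      refine h.2 _ _ _ ⟨A ++ a :: v :: B', C, ?_⟩
      rw [hB']
      simp
    refine ⟨fun hcol => ?_, fun hcol hv => ?_⟩
    · by_cases hcv : G.Adj c v
      · exact hfirst.1 ⟨hcol.1, hcv⟩
      · have hvc : G.Adj v c := (hG.skel_adj.1 hloop.1.rel).resolve_right hcv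
        rcases hloop.descent hG hvc with ⟨d, hd, hvd⟩ | hw
        · exact ⟨d, hd, hvd.to_reflTransGen⟩
        · refine absurd (hw v ?_) (hG v)
          simp [List.getLast?_cons]
    · by_cases ha : G.Adj a v
      · exact hlast.2 (fun h => hcol ⟨ha, h.2⟩) hv
      · exact hfirst.2 (fun h => ha h.1) hv

/-- An open trail contains an open path with the same ends. -/
theorem Trail.exists_nodup (hG : IsDAG G) {i j : V} : ∀ {l : List V}, Trail G S l →
    l.head? = some i → l.getLast? = some j →
    ∃ l', Trail G S l' ∧ l'.Nodup ∧ l'.head? = some i ∧ l'.getLast? = some j := by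
  intro l
  induction hn : l.length using Nat.strong_induction_on generalizing l with
  | _ n ih =>
    intro hl hi hj
    by_cases hnd : l.Nodup
    · exact ⟨l, hl, hnd, hi, hj⟩
    · obtain ⟨v, A, B, C, rfl⟩ := exists_append_of_not_nodup hnd
      refine ih _ ?_ rfl (hl.cut hG) ?_ ?_
      · rw [← hn]
        simp only [List.length_append, List.length_cons]
        omega
      · rcases A with _ | ⟨a, A⟩ <;> simpa using hi
      · simpa [List.getLast?_append, List.getLast?_cons] using hj

theorem dSep_iff_nodup {i j : V} :
    DSep G i j S ↔ ∀ l, Trail G S l → l.Nodup → l.head? = some i → l.getLast? ≠ some j := by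
  constructor
  · intro h l hl hnd hi hj
    have hne : l ≠ [] := by
      rintro rfl
      simp at hi
    have hi' : l.head hne = i := by
      rw [List.head?_eq_some_head hne] at hi
      exact Option.some.inj hi
    have hj' : l.getLast hne = j := by
      rw [List.getLast?_eq_some_getLast hne] at hj
      exact Option.some.inj hj
    subst hi' hj'
    refine h (SimpleGraph.Walk.ofSupport l hne hl.1) ?_ ?_
    · rw [SimpleGraph.Walk.isPath_def, SimpleGraph.Walk.support_ofSupport]
      exact hnd
    · rw [SimpleGraph.Walk.support_ofSupport]
      exact hl.2
  · intro h p hp ho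
    refine h p.support ⟨p.isChain_adj_support, ho⟩ hp.support_nodup ?_ ?_
    · rw [List.head?_eq_some_head p.support_ne_nil, SimpleGraph.Walk.head_support]
    · rw [List.getLast?_eq_some_getLast p.support_ne_nil, SimpleGraph.Walk.getLast_support]

/-- d-separation can be tested on trails with repeated vertices. -/
theorem dSep_iff (hG : IsDAG G) {i j : V} :
    DSep G i j S ↔ ∀ l, Trail G S l → l.head? = some i → l.getLast? ≠ some j := by
  rw [dSep_iff_nodup]
  refine ⟨fun h l hl hi hj => ?_, fun h l hl _ => h l hl⟩
  obtain ⟨l', h1, h2, h3, h4⟩ := hl.exists_nodup hG hi hj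
  exact h l' h1 h2 h3 h4

theorem DSep.symm (hG : IsDAG G) {i j : V} (h : DSep G i j S) : DSep G j i S := by
  rw [dSep_iff hG] at h ⊢
  intro l hl hi hj
  exact h l.reverse hl.reverse (by simpa using hj) (by simpa using hi)

theorem not_dSep_of_adj (hG : IsDAG G) {i j : V} (h : (skel G).Adj i j) : ¬ DSep G i j S :=
  fun hs => (dSep_iff hG).1 hs [i, j] (trail_pair.2 h) rfl rfl

theorem not_dSep_of_collider (hG : IsDAG G) {i m j : V} (him : G.Adj i m) (hjm : G.Adj j m)
    (hm : m ∈ S) : ¬ DSep G i j S := by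
  refine fun hs => (dSep_iff hG).1 hs [i, m, j] (trail_cons.2 ⟨hG.skel_adj.2 (.inl him), ?_,
    trail_pair.2 (hG.skel_adj.2 (.inr hjm))⟩) rfl rfl
  exact ⟨fun _ => ⟨m, hm, .refl⟩, fun h => absurd ⟨him, hjm⟩ h⟩

theorem mem_of_dSep_of_not_collider (hG : IsDAG G) {i m j : V} (him : (skel G).Adj i m)
    (hmj : (skel G).Adj m j) (hc : ¬ (G.Adj i m ∧ G.Adj j m)) (hs : DSep G i j S) : m ∈ S := by
  by_contra hm
  refine (dSep_iff hG).1 hs [i, m, j] (trail_cons.2 ⟨him, ?_, trail_pair.2 hmj⟩) rfl rfl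
  exact ⟨fun h => absurd h hc, fun _ => hm⟩

open Classical in
/-- The set of parents of a vertex. -/
noncomputable def parents [Fintype V] (G : Digraph V) (i : V) : Finset V :=
  Finset.univ.filter fun v => G.Adj v i

theorem mem_parents [Fintype V] {i v : V} : v ∈ parents G i ↔ G.Adj v i := by
  simp [parents]

/-- The local Markov property: a vertex is separated by its parents from its nondescendants. -/
theorem dSep_parents [Fintype V] (hG : IsDAG G) {i k : V} (hik : i ≠ k)
    (hadj : ¬ (skel G).Adj i k) (hdesc : ¬ Relation.TransGen G.Adj i k) :
    DSep G i k (parents G i) := by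
  rw [dSep_iff hG]
  intro l hl hi hk
  rcases l with _ | ⟨x, _ | ⟨a, t⟩⟩
  · simp at hi
  · simp_all
  · obtain rfl : x = i := by simpa using hi
    by_cases hxa : G.Adj x a
    · rcases hl.descent hG hxa with ⟨d, hd, hxd⟩ | hw
      · exact hG x (hxd.tail (mem_parents.1 hd))
      · refine hdesc (hw k ?_)
        rw [List.getLast?_cons_cons] at hk
        exact hk
    · rcases t with _ | ⟨b, t⟩
      · obtain rfl : a = k := by simpa using hk
        exact hadj hl.1.rel
      · have hax : G.Adj a x := (hG.skel_adj.1 hl.1.rel).resolve_left hxa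
        exact (trail_cons.1 hl).2.1.2 (fun h => hxa h.1) (mem_parents.2 hax)

/-- Two nonadjacent vertices are separated by the parents of one of them. -/
theorem dSep_parents_or [Fintype V] (hG : IsDAG G) {i k : V} (hik : i ≠ k)
    (hadj : ¬ (skel G).Adj i k) :
    DSep G i k (parents G i) ∨ DSep G i k (parents G k) := by
  by_cases h : Relation.TransGen G.Adj i k
  · right
    refine (dSep_parents hG hik.symm (fun h => hadj h.symm) fun h' => ?_).symm hG
    exact hG i (h.trans h')
  · exact .inl (dSep_parents hG hik hadj h)

theorem notMem_parents_self [Fintype V] (hG : IsDAG G) (i : V) : i ∉ parents G i :=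
  fun h => hG i (.single (mem_parents.1 h))

theorem notMem_parents_of_not_adj [Fintype V] (hG : IsDAG G) {i k : V}
    (hadj : ¬ (skel G).Adj i k) : k ∉ parents G i :=
  fun h => hadj (hG.skel_adj.2 (.inr (mem_parents.1 h)))

/-- Nonadjacent vertices have a separating set which consists of neighbours of one of them. -/
theorem exists_dSep [Fintype V] (hG : IsDAG G) {i k : V} (hik : i ≠ k)
    (hadj : ¬ (skel G).Adj i k) :
    ∃ S : Finset V, i ∉ S ∧ k ∉ S ∧ DSep G i k S ∧
      ((∀ s ∈ S, G.Adj s i) ∨ ∀ s ∈ S, G.Adj s k) := by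
  rcases dSep_parents_or hG hik hadj with h | h
  · exact ⟨_, notMem_parents_self hG i, notMem_parents_of_not_adj hG hadj, h,
      .inl fun s hs => mem_parents.1 hs⟩
  · exact ⟨_, notMem_parents_of_not_adj hG fun h => hadj h.symm, notMem_parents_self hG k, h,
      .inr fun s hs => mem_parents.1 hs⟩

/-- Markov equivalent acyclic graphs have the same skeleton and the same v-structures. -/
theorem MarkovEquiv.samePattern [Fintype V] {G' : Digraph V} (hG : IsDAG G) (hG' : IsDAG G')
    (h : MarkovEquiv G G') : SamePattern G G' := by
  have hsymm : MarkovEquiv G' G := fun i j S hij hi hj => (h i j S hij hi hj).symm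
  have skel_le : ∀ {G G' : Digraph V}, IsDAG G → IsDAG G' → MarkovEquiv G G' →
      ∀ a b, (skel G).Adj a b → (skel G').Adj a b := by
    intro G G' hG hG' h a b hab
    by_contra hab'
    obtain ⟨S, ha, hb, hS, -⟩ := exists_dSep hG' hab.ne hab'
    exact not_dSep_of_adj hG hab ((h a b S hab.ne ha hb).2 hS)
  have vs_le : ∀ {G G' : Digraph V}, IsDAG G → IsDAG G' → MarkovEquiv G G' →
      MarkovEquiv G' G → ∀ a b c, VStruct G a b c → VStruct G' a b c := by
    intro G G' hG hG' h h' a b c ⟨hab, hcb, hne, hac⟩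
    have hac' : ¬ (skel G').Adj a c := fun h0 => hac (skel_le hG' hG h' a c h0)
    obtain ⟨S, ha, hc, hS, -⟩ := exists_dSep hG' hne hac'
    have hb : b ∉ S := fun hb =>
      not_dSep_of_collider hG hab hcb hb ((h a c S hne ha hc).2 hS)
    by_contra hv
    refine hb (mem_of_dSep_of_not_collider hG' (m := b)
      (skel_le hG hG' h _ _ (hG.skel_adj.2 (.inl hab)))
      (skel_le hG hG' h _ _ (hG.skel_adj.2 (.inr hcb))) ?_ hS)
    exact fun h0 => hv ⟨h0.1, h0.2, hne, hac'⟩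
  exact ⟨fun a b => ⟨skel_le hG hG' h a b, skel_le hG' hG hsymm a b⟩,
    fun a b c => ⟨vs_le hG hG' h hsymm a b c, vs_le hG' hG hsymm h a b c⟩⟩

end Trails

/-! ### The Bayes ball -/

section BayesBall

variable {V : Type*} {G : Digraph V} {S : Finset V}

/-- The positions of a ball that starts at `i` and moves along edges of `G`, in either direction.
The state of the ball is its vertex, together with `true` if it arrived from a parent of that
vertex, and `false` if it arrived from a child or has not moved yet. Outside `S`, the ball passes
through unless it arrived from a parent and would leave to a parent; in `S`, a ball that arrived
from a parent bounces back to the parents, and all others are stopped. -/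
inductive Ball (G : Digraph V) (S : Finset V) (i : V) : V → Bool → Prop
  | start : Ball G S i i false
  | up {v p : V} : Ball G S i v false → v ∉ S → G.Adj p v → Ball G S i p false
  | down {v c : V} {d : Bool} : Ball G S i v d → v ∉ S → G.Adj v c → Ball G S i c true
  | bounce {v p : V} : Ball G S i v true → v ∈ S → G.Adj p v → Ball G S i p false

/-- A ball that arrives at a vertex outside `S` which has a descendant in `S` can go down to `S`,
bounce, and come back from below. -/
theorem Ball.return {i m d : V} (hd : d ∈ S) (hmd : Relation.ReflTransGen G.Adj m d) :
    m ∉ S → Ball G S i m true → Ball G S i m false := by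
  induction hmd using Relation.ReflTransGen.head_induction_on with
  | refl => exact fun h => absurd hd h
  | @head a c hac _ ih =>
    intro ha hb
    have hc := Ball.down hb ha hac
    by_cases hcS : c ∈ S
    · exact .bounce hc hcS hac
    · exact .up (ih hcS hc) hcS hac

/-- The ball follows open trails. -/
theorem Ball.follow (hG : IsDAG G) {i j : V} : ∀ {t : List V} {a m : V}, Trail G S (a :: m :: t) →
    (m :: t).getLast? = some j → (G.Adj a m → Ball G S i m true) →
    (G.Adj m a → Ball G S i m false) → ∃ d, Ball G S i j d := by
  intro t
  induction t with
  | nil =>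
    intro a m ht hj h1 h2
    obtain rfl : m = j := by simpa using hj
    rcases hG.skel_adj.1 ht.1.rel with h | h
    exacts [⟨_, h1 h⟩, ⟨_, h2 h⟩]
  | cons b t ih =>
    intro a m ht hj h1 h2
    obtain ⟨ham, ho, ht'⟩ := trail_cons.1 ht
    rw [List.getLast?_cons_cons] at hj
    have ham' := hG.skel_adj.1 ham
    refine ih ht' hj (fun hmb => ?_) (fun hbm => ?_)
    · have hm : m ∉ S := ho.2 fun h => hG.asymm hmb h.2
      rcases ham' with h | h
      exacts [.down (h1 h) hm hmb, .down (h2 h) hm hmb]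
    · rcases ham' with h | h
      · obtain ⟨d, hd, hmd⟩ := ho.1 ⟨h, hbm⟩
        by_cases hm : m ∈ S
        · exact .bounce (h1 h) hm hbm
        · exact .up (Ball.return hd hmd hm (h1 h)) hm hbm
      · have hm : m ∉ S := ho.2 fun h' => hG.asymm h h'.1
        exact .up (h2 h) hm hbm

/-- The route of the ball is an open trail, listed here from its end to its start. -/
theorem Ball.exists_trail (hG : IsDAG G) {i v : V} {d : Bool}
    (h : Ball G S i v d) : ∃ t, Trail G S (v :: t) ∧ (v :: t).getLast? = some i ∧
      (d = true → ∃ a t', t = a :: t' ∧ G.Adj a v) ∧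
      (d = false → t ≠ [] → ∃ a t', t = a :: t' ∧ G.Adj v a) := by
  induction h with
  | start => exact ⟨[], trail_singleton _, rfl, by simp, by simp⟩
  | @up v p _ hv hp ih =>
    obtain ⟨t, ht, hl, -, h2⟩ := ih
    refine ⟨v :: t, ?_, by rw [List.getLast?_cons_cons, hl], by simp, fun _ _ => ⟨_, _, rfl, hp⟩⟩
    rcases t with _ | ⟨a, t⟩
    · exact trail_pair.2 (hG.skel_adj.2 (.inl hp))
    · obtain ⟨a, t, ⟨⟩, ha⟩ := h2 rfl (List.cons_ne_nil _ _)
      exact trail_cons.2 ⟨hG.skel_adj.2 (.inl hp),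
        ⟨fun h => absurd h.2 (hG.asymm ha), fun _ => hv⟩, ht⟩
  | @down v c d _ hv hc ih =>
    obtain ⟨t, ht, hl, -, -⟩ := ih
    refine ⟨v :: t, ?_, by rw [List.getLast?_cons_cons, hl], fun _ => ⟨_, _, rfl, hc⟩, by simp⟩
    rcases t with _ | ⟨a, t⟩
    · exact trail_pair.2 (hG.skel_adj.2 (.inr hc))
    · exact trail_cons.2 ⟨hG.skel_adj.2 (.inr hc),
        ⟨fun h => absurd h.1 (hG.asymm hc), fun _ => hv⟩, ht⟩
  | @bounce v p _ hv hp ih =>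
    obtain ⟨t, ht, hl, h1, -⟩ := ih
    refine ⟨v :: t, ?_, by rw [List.getLast?_cons_cons, hl], by simp, fun _ _ => ⟨_, _, rfl, hp⟩⟩
    obtain ⟨a, t, rfl, ha⟩ := h1 rfl
    exact trail_cons.2 ⟨hG.skel_adj.2 (.inl hp),
      ⟨fun _ => ⟨v, hv, .refl⟩, fun h => absurd ⟨hp, ha⟩ h⟩, ht⟩

theorem dSep_iff_ball (hG : IsDAG G) {i j : V} (hij : i ≠ j) (hi : i ∉ S) :
    DSep G i j S ↔ ∀ d, ¬ Ball G S i j d := by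
  constructor
  · intro h d hb
    obtain ⟨t, ht, hl, -⟩ := hb.exists_trail hG
    exact (dSep_iff hG).1 (h.symm hG) _ ht rfl hl
  · intro h
    rw [dSep_iff hG]
    intro l hl hi' hj
    rcases l with _ | ⟨x, _ | ⟨a, t⟩⟩
    · simp at hi'
    · simp_all
    · obtain rfl : x = i := by simpa using hi'
      rw [List.getLast?_cons_cons] at hj
      obtain ⟨d, hd⟩ := Ball.follow hG (i := x) hl hj (fun h => .down .start hi h)
        (fun h => .up .start hi h)
      exact h d hd

end BayesBall

/-! ### Reversing covered edges -/

section Covered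

variable {V : Type*} {G : Digraph V} {S : Finset V}

/-- The edge `x → y` is covered: the other parents of `y` are the parents of `x`. -/
def Covered (G : Digraph V) (x y : V) : Prop :=
  G.Adj x y ∧ ∀ z, G.Adj z y ↔ G.Adj z x ∨ z = x

/-- The graph in which the edge `x → y` is replaced by `y → x`. -/
def reverseEdge (G : Digraph V) (x y : V) : Digraph V where
  Adj a b := (G.Adj a b ∧ ¬ (a = x ∧ b = y)) ∨ (a = y ∧ b = x)

theorem reverseEdge_adj {x y a b : V} : (reverseEdge G x y).Adj a b ↔
    (G.Adj a b ∧ ¬ (a = x ∧ b = y)) ∨ (a = y ∧ b = x) := Iff.rfl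

/-- In a topological order, `y` can be moved to the place just before `x`. -/
theorem Covered.isDAG [Finite V] (hG : IsDAG G) {x y : V} (h : Covered G x y) :
    IsDAG (reverseEdge G x y) := by
  classical
  obtain ⟨f, hf⟩ := hG.exists_rank
  have hxy := hf x y h.1
  refine IsDAG.of_rank (fun v => if v = y then 2 * f x + 1 else 2 * f v + 2) ?_
  rintro a b (⟨hab, hne⟩ | ⟨rfl, rfl⟩)
  · have hlt := hf a b hab
    by_cases hb : b = y
    · subst hb
      have hax : G.Adj a x := ((h.2 a).1 hab).resolve_right fun h => hne ⟨h, rfl⟩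
      have := hf a x hax
      simp only [hG.ne hab, if_false, if_true]
      omega
    · by_cases ha : a = y
      · subst ha
        simp only [hb, if_false, if_true]
        omega
      · simp only [hb, ha, if_false]
        omega
  · simp only [if_true, (hG.ne h.1), if_false]
    omega

theorem Covered.reverse (hG : IsDAG G) {x y : V} (h : Covered G x y) :
    Covered (reverseEdge G x y) y x := by
  refine ⟨.inr ⟨rfl, rfl⟩, fun z => ?_⟩
  have hne := hG.ne h.1
  have hz := h.2 z
  have h1 : z = x → ¬ G.Adj z x := by
    rintro rfl h
    exact hG.ne h rfl
  simp only [reverseEdge_adj]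
  grind

theorem reverseEdge_reverseEdge (hG : IsDAG G) {x y : V} (h : G.Adj x y) :
    reverseEdge (reverseEdge G x y) y x = G := by
  ext a b
  have := hG.asymm h
  simp only [reverseEdge_adj]
  grind

theorem Covered.samePattern (hG : IsDAG G) {x y : V} (h : Covered G x y)
    (hG' : IsDAG (reverseEdge G x y)) : SamePattern G (reverseEdge G x y) := by
  have hxy := h.1
  have hsk : ∀ a b, (skel G).Adj a b ↔ (skel (reverseEdge G x y)).Adj a b := by
    intro a b
    rw [hG.skel_adj, hG'.skel_adj]
    simp only [reverseEdge_adj]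
    grind
  refine ⟨hsk, fun a b c => ?_⟩
  simp only [VStruct, ← hsk, hG.skel_adj, reverseEdge_adj]
  have h2 := h.2
  grind

set_option maxHeartbeats 1600000 in
/-- Reversing a covered edge `x → y` does not change where the ball can go. A ball that comes from a
common parent arrives at `x` and `y` simultaneously, and the route of a ball that arrives from below
at one of them can be changed to use the reversed edge. The exact claim about the arrivals at `x`
and `y` depends on which of the two vertices are in `S`. -/
theorem Covered.ball_aux (hG : IsDAG G) {x y : V} (h : Covered G x y) {i v : V} {d : Bool}
    (hb : Ball G S i v d) :
    (v ≠ x → v ≠ y → Ball (reverseEdge G x y) S i v d) ∧ (v = x ∨ v = y →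
      (x ∉ S → y ∉ S → Ball (reverseEdge G x y) S i x false ∨
        Ball (reverseEdge G x y) S i y false ∨
        (d = true ∧ Ball (reverseEdge G x y) S i x true ∧
          Ball (reverseEdge G x y) S i y true)) ∧
      (x ∈ S → (d = false → v = y → y ∉ S → Ball (reverseEdge G x y) S i y false) ∧
        (d = true → Ball (reverseEdge G x y) S i x true ∧
          Ball (reverseEdge G x y) S i y true)) ∧
      (x ∉ S → y ∈ S → (v = x ∨ d = true → Ball (reverseEdge G x y) S i x false ∨
          (Ball (reverseEdge G x y) S i x true ∧ Ball (reverseEdge G x y) S i y true)) ∧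
        (v = x → d = true → Ball (reverseEdge G x y) S i x true ∧
          Ball (reverseEdge G x y) S i y true))) := by
  have hne := hG.ne h.1
  have hyx : (reverseEdge G x y).Adj y x := .inr ⟨rfl, rfl⟩
  have hpx : ∀ u, G.Adj u x → u ≠ x ∧ u ≠ y ∧ (reverseEdge G x y).Adj u x ∧
      (reverseEdge G x y).Adj u y := fun u hu =>
    ⟨hG.ne hu, fun e => hG.asymm h.1 (e ▸ hu), .inl ⟨hu, fun e => hne e.2⟩,
      .inl ⟨(h.2 u).2 (.inl hu), fun e => hG.ne hu e.1⟩⟩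
  have hpy : ∀ u, G.Adj u y → u = x ∨ (u ≠ x ∧ u ≠ y ∧ (reverseEdge G x y).Adj u x ∧
      (reverseEdge G x y).Adj u y) := fun u hu =>
    ((h.2 u).1 hu).symm.imp_right (hpx u)
  have hother : ∀ a b, G.Adj a b → b ≠ x → b ≠ y → (reverseEdge G x y).Adj a b :=
    fun a b hab _ hby => .inl ⟨hab, fun e => hby e.2⟩
  have hstart := Ball.start (G := reverseEdge G x y) (S := S) (i := i)
  have hup := fun v p => Ball.up (G := reverseEdge G x y) (S := S) (i := i) (v := v) (p := p)
  have hdown := fun v p d =>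
    Ball.down (G := reverseEdge G x y) (S := S) (i := i) (v := v) (c := p) (d := d)
  have hbounce := fun v p =>
    Ball.bounce (G := reverseEdge G x y) (S := S) (i := i) (v := v) (p := p)
  -- from here on, only the facts above about the reversed graph matter
  generalize reverseEdge G x y = G' at *
  induction hb with
  | start => grind
  | @up v p _ hv hp ih =>
    by_cases hvx : v = x <;> by_cases hvy : v = y <;> by_cases hpx : p = x <;>
      by_cases hpy : p = y <;> by_cases hxS : x ∈ S <;> by_cases hyS : y ∈ S <;> grind
  | @down v c d _ hv hc ih =>
    by_cases hvx : v = x <;> by_cases hvy : v = y <;> by_cases hcx : c = x <;>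
      by_cases hcy : c = y <;> by_cases hxS : x ∈ S <;> by_cases hyS : y ∈ S <;> grind
  | @bounce v p _ hv hp ih =>
    by_cases hvx : v = x <;> by_cases hvy : v = y <;> by_cases hpx : p = x <;>
      by_cases hpy : p = y <;> by_cases hxS : x ∈ S <;> by_cases hyS : y ∈ S <;> grind

theorem Covered.ball (hG : IsDAG G) {x y : V} (h : Covered G x y) {i j : V} (hj : j ∉ S)
    (hb : ∃ d, Ball G S i j d) : ∃ d, Ball (reverseEdge G x y) S i j d := by
  obtain ⟨d, hb⟩ := hb
  have hyx : (reverseEdge G x y).Adj y x := .inr ⟨rfl, rfl⟩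
  obtain ⟨h1, h2⟩ := h.ball_aux hG hb
  by_cases hjx : j = x
  · subst hjx
    obtain ⟨h3, -, h4⟩ := h2 (.inl rfl)
    by_cases hy : y ∈ S
    · rcases (h4 hj hy).1 (.inl rfl) with h | h
      exacts [⟨_, h⟩, ⟨_, h.1⟩]
    · rcases h3 hj hy with h | h | h
      exacts [⟨_, h⟩, ⟨_, h.down hy hyx⟩, ⟨_, h.2.1⟩]
  by_cases hjy : j = y
  · subst hjy
    obtain ⟨h3, h4, -⟩ := h2 (.inr rfl)
    by_cases hx : x ∈ S
    · rcases d with _ | _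
      exacts [⟨_, (h4 hx).1 rfl rfl hj⟩, ⟨_, ((h4 hx).2 rfl).2⟩]
    · rcases h3 hx hj with h | h | h
      exacts [⟨_, h.up hx hyx⟩, ⟨_, h⟩, ⟨_, h.2.2⟩]
  exact ⟨d, h1 hjx hjy⟩

theorem Covered.markovEquiv [Finite V] (hG : IsDAG G) {x y : V} (h : Covered G x y) :
    MarkovEquiv G (reverseEdge G x y) := by
  intro i j S hij hi hj
  have hG' := h.isDAG hG
  rw [dSep_iff_ball hG hij hi, dSep_iff_ball hG' hij hi]
  constructor
  · intro hs d hd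
    obtain ⟨d', hd'⟩ := (h.reverse hG).ball hG' hj ⟨d, hd⟩
    rw [reverseEdge_reverseEdge hG h.1] at hd'
    exact hs d' hd'
  · intro hs d hd
    obtain ⟨d', hd'⟩ := h.ball hG hj ⟨d, hd⟩
    exact hs d' hd'

/-- If two acyclic graphs with the same pattern differ, then some covered edge of the first is
reversed in the second: among the edges which are reversed, choose one whose head comes first, and
among those with this head, one whose tail comes last. -/
theorem SamePattern.exists_covered [Finite V] {G' : Digraph V} (hG : IsDAG G) (hG' : IsDAG G')
    (h : SamePattern G G') {a b : V} (hab : G.Adj a b) (hba : G'.Adj b a) :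
    ∃ x y, Covered G x y ∧ G'.Adj y x := by
  classical
  have := Fintype.ofFinite V
  obtain ⟨f, hf⟩ := hG.exists_rank
  have hadj : ∀ u v, (G.Adj u v ∨ G.Adj v u) ↔ (G'.Adj u v ∨ G'.Adj v u) := by
    intro u v
    rw [← hG.skel_adj, ← hG'.skel_adj, h.skel_adj]
  obtain ⟨y, hy, hymin⟩ := Finset.exists_min_image
    (Finset.univ.filter fun y => ∃ x, G.Adj x y ∧ G'.Adj y x) f ⟨b, by simpa using ⟨a, hab, hba⟩⟩
  simp only [Finset.mem_filter, Finset.mem_univ, true_and] at hy hymin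
  obtain ⟨x, hx, hxmax⟩ := Finset.exists_max_image
    (Finset.univ.filter fun x => G.Adj x y ∧ G'.Adj y x) f (by simpa [Finset.Nonempty] using hy)
  simp only [Finset.mem_filter, Finset.mem_univ, true_and] at hx hxmax
  obtain ⟨hxy, hyx⟩ := hx
  -- edges whose head comes before `y` have the same direction in both graphs
  have hsame : ∀ u v, G.Adj u v → f v < f y → G'.Adj u v := by
    intro u v huv hv
    refine ((hadj u v).1 (.inl huv)).resolve_right fun hvu => ?_
    exact absurd (hymin v ⟨u, huv, hvu⟩) (by omega)
  have hfxy := hf x y hxy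
  refine ⟨x, y, ⟨hxy, fun z => ⟨fun hzy => ?_, ?_⟩⟩, hyx⟩
  · by_contra! hz
    have hskel : (skel G).Adj x z := by
      by_contra hxz
      have hv : VStruct G x y z := ⟨hxy, hzy, hz.2.symm, hxz⟩
      exact hG'.asymm hyx ((h.vStruct _ _ _).1 hv).1
    have hxz : G.Adj x z := (hG.skel_adj.1 hskel).resolve_right hz.1
    have hfxz := hf x z hxz
    have hzy' : G'.Adj z y := by
      refine ((hadj z y).1 (.inl hzy)).resolve_right fun hyz => ?_
      exact absurd (hxmax z ⟨hzy, hyz⟩) (by omega)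
    exact hG'.no_triangle (hsame x z hxz (hf z y hzy)) hzy' hyx
  · rintro (hzx | rfl)
    · have hzx' := hsame z x hzx hfxy
      have hfzx := hf z x hzx
      have hskel : (skel G).Adj y z := by
        by_contra hyz
        have hne : y ≠ z := by
          rintro rfl
          omega
        have hv : VStruct G' y x z :=
          ⟨hyx, hzx', hne, fun h0 => hyz ((h.skel_adj _ _).2 h0)⟩
        exact hG.asymm hxy ((h.vStruct _ _ _).2 hv).1
      refine (hG.skel_adj.1 hskel).resolve_left fun hyz => ?_
      have := hf y z hyz
      omega
    · exact hxy

/-- Acyclic graphs with the same skeleton and the same v-structures are Markov equivalent, by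
induction on the number of edges with different directions. -/
theorem SamePattern.markovEquiv [Finite V] {G' : Digraph V} (hG : IsDAG G) (hG' : IsDAG G')
    (h : SamePattern G G') : MarkovEquiv G G' := by
  induction hn : {p : V × V | G.Adj p.1 p.2 ∧ G'.Adj p.2 p.1}.ncard using
    Nat.strong_induction_on generalizing G with
  | _ n ih =>
    by_cases hex : ∃ a b, G.Adj a b ∧ G'.Adj b a
    · obtain ⟨a, b, hab, hba⟩ := hex
      obtain ⟨x, y, hc, hyx⟩ := h.exists_covered hG hG' hab hba
      have hG1 := hc.isDAG hG
      have hlt : {p : V × V | (reverseEdge G x y).Adj p.1 p.2 ∧ G'.Adj p.2 p.1}.ncard < n := by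
        rw [← hn]
        refine Set.ncard_lt_ncard ⟨?_, fun hsub => ?_⟩ (Set.toFinite _)
        · rintro ⟨u, v⟩ ⟨huv | huv, hvu⟩
          · exact ⟨huv.1, hvu⟩
          · obtain ⟨rfl, rfl⟩ := huv
            exact absurd hvu (hG'.asymm hyx)
        · have hmem : (x, y) ∈ {p : V × V | G.Adj p.1 p.2 ∧ G'.Adj p.2 p.1} := ⟨hc.1, hyx⟩
          rcases (hsub hmem).1 with h0 | h0
          · exact h0.2 ⟨rfl, rfl⟩
          · exact hG.ne hc.1 h0.1
      have h1 := ih _ hlt hG1 ((hc.samePattern hG hG1).symm.trans h) rfl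
      intro i j S hij hi hj
      exact (hc.markovEquiv hG i j S hij hi hj).trans (h1 i j S hij hi hj)
    · have heq : G = G' := by
        ext a b
        have hadj : (G.Adj a b ∨ G.Adj b a) ↔ (G'.Adj a b ∨ G'.Adj b a) := by
          rw [← hG.skel_adj, ← hG'.skel_adj, h.skel_adj]
        constructor
        · exact fun hab => (hadj.1 (.inl hab)).resolve_right fun hba => hex ⟨a, b, hab, hba⟩
        · exact fun hab => (hadj.2 (.inl hab)).resolve_right fun hba => hex ⟨b, a, hba, hab⟩
      subst heq
      exact fun i j S _ _ _ => Iff.rfl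

/-- The Markov equivalence class consists of the acyclic graphs with the same skeleton and the same
v-structures. -/
theorem mem_MEC_iff [Fintype V] {G' : Digraph V} (hG : IsDAG G) :
    G' ∈ MEC G ↔ IsDAG G' ∧ SamePattern G G' :=
  ⟨fun h => ⟨h.1, h.2.samePattern hG h.1⟩, fun h => ⟨h.1, h.2.markovEquiv hG h.1⟩⟩

end Covered

/-! ### Perfect orders of chordal graphs -/

section Chordal

variable {V : Type*} {U : V → V → Prop}

/-- The vertex `s` of `W` is simplicial: its neighbours in `W` are pairwise adjacent. -/
def Simplicial (U : V → V → Prop) (W : Finset V) (s : V) : Prop :=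
  s ∈ W ∧ ∀ x ∈ W, ∀ y ∈ W, U x s → U y s → x ≠ y → U x y

/-- A form of Dirac's theorem: if every nonempty induced subgraph has a simplicial vertex, then
there is one outside any given proper clique. -/
theorem exists_simplicial_notMem (hsymm : ∀ a b, U a b → U b a)
    (hU : ∀ W : Finset V, W.Nonempty → ∃ s, Simplicial U W s) {W : Finset V} {C : Set V}
    (hC : ∀ x ∈ C, ∀ y ∈ C, x ≠ y → U x y) (hW : ∃ w ∈ W, w ∉ C) :
    ∃ s, Simplicial U W s ∧ s ∉ C := by
  classical
  induction hn : W.card using Nat.strong_induction_on generalizing W C with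
  | _ n ih =>
    obtain ⟨w, hw, hwC⟩ := hW
    obtain ⟨s, hs⟩ := hU W ⟨w, hw⟩
    by_cases hsC : s ∈ C
    swap
    · exact ⟨s, hs, hsC⟩
    by_cases hall : ∀ t ∈ W.erase s, U t s
    · -- `W` is a clique, so all its vertices are simplicial
      refine ⟨w, ⟨hw, fun x hx y hy _ _ hxy => ?_⟩, hwC⟩
      by_cases hxs : x = s
      · subst hxs
        exact hsymm _ _ (hall y (Finset.mem_erase.2 ⟨hxy.symm, hy⟩))
      by_cases hys : y = s
      · subst hys
        exact hall x (Finset.mem_erase.2 ⟨hxs, hx⟩)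
      exact hs.2 x hx y hy (hall x (Finset.mem_erase.2 ⟨hxs, hx⟩))
        (hall y (Finset.mem_erase.2 ⟨hys, hy⟩)) hxy
    · push Not at hall
      obtain ⟨t, ht, hts⟩ := hall
      obtain ⟨r, hr, hrC⟩ := ih _ (by rw [← hn]; exact Finset.card_erase_lt_of_mem hs.1)
        (W := W.erase s) (C := {t | t ∈ W ∧ U t s})
        (fun x hx y hy hxy => hs.2 x hx.1 y hy.1 hx.2 hy.2 hxy) ⟨t, ht, fun h => hts h.2⟩ rfl
      obtain ⟨hrs, hrW⟩ := Finset.mem_erase.1 hr.1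
      have hrs' : ¬ U r s := fun h => hrC ⟨hrW, h⟩
      have hne : ∀ x, U x r → x ≠ s := by
        rintro x hx rfl
        exact hrs' (hsymm _ _ hx)
      refine ⟨r, ⟨hrW, fun x hx y hy hxr hyr hxy => ?_⟩, fun hrC' => hrs' (hC r hrC' s hsC hrs)⟩
      exact hr.2 x (Finset.mem_erase.2 ⟨hne x hxr, hx⟩) y (Finset.mem_erase.2 ⟨hne y hyr, hy⟩)
        hxr hyr hxy

/-- If every nonempty induced subgraph has a simplicial vertex, then the vertices can be ordered
such that a given vertex `r` comes first and the neighbours which precede any vertex are pairwise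
adjacent. -/
theorem exists_perfect_order (hsymm : ∀ a b, U a b → U b a)
    (hU : ∀ W : Finset V, W.Nonempty → ∃ s, Simplicial U W s) (r : V) {W : Finset V}
    (hr : r ∈ W) :
    ∃ f : V → ℕ, Set.InjOn f W ∧ (∀ x ∈ W, x ≠ r → f r < f x) ∧
      ∀ z ∈ W, ∀ x ∈ W, ∀ y ∈ W, U x z → U y z → f x < f z → f y < f z → x ≠ y → U x y := by
  classical
  induction hn : W.card using Nat.strong_induction_on generalizing W with
  | _ n ih =>
    by_cases hW : ∃ w ∈ W, w ∉ ({r} : Set V)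
    · obtain ⟨s, hs, hsr⟩ := exists_simplicial_notMem hsymm hU (C := {r})
        (by rintro x rfl y rfl h; exact absurd rfl h) hW
      have hsr' : s ≠ r := hsr
      obtain ⟨f, hinj, hfirst, hperf⟩ := ih _
        (by rw [← hn]; exact Finset.card_erase_lt_of_mem hs.1) (W := W.erase s)
        (Finset.mem_erase.2 ⟨hsr'.symm, hr⟩) rfl
      have hlt : ∀ x ∈ W, f x < W.sup f + 1 := fun x hx =>
        Nat.lt_succ_of_le (Finset.le_sup (f := f) hx)
      simp only [Set.InjOn, Finset.coe_erase, Set.mem_sdiff, Finset.mem_coe, Set.mem_singleton_iff,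
        Finset.mem_erase] at hinj hfirst hperf
      -- put `s` behind all other vertices
      refine ⟨fun v => if v = s then W.sup f + 1 else f v, ?_, ?_, ?_⟩
      · intro x hx y hy hxy
        have := hlt x hx
        have := hlt y hy
        have := @hinj x
        grind
      · intro x hx hxr
        have := hlt r hr
        grind
      · intro z hz x hx y hy hxz hyz hfx hfy hxy
        have := hlt z hz
        have := hs.2 x hx y hy
        have := hperf z
        grind
    · push Not at hW
      have hW' : ∀ x ∈ W, x = r := hW
      refine ⟨fun _ => 0, fun x hx y hy _ => (hW' x hx).trans (hW' y hy).symm,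
        fun x hx hxr => absurd (hW' x hx) hxr, fun z _ x _ y _ _ _ h => absurd h (lt_irrefl _)⟩

end Chordal

/-! ### Soundness and completeness of Meek's rules -/

section Meek

variable {V : Type*} {G : Digraph V} {H : PDAG V}

/-- What holds of the partially directed graphs that arise from the pattern of `G` by Meek's rules:
they have the skeleton of `G`, their directed edges include those of the v-structures and are
compelled, and each directed edge is in a v-structure or is justified by one of the rules. In the
justification by the third rule, the edges at `a` may have been directed after the rule was applied,
but they do not both point to `a`. -/
structure MeekInv (G : Digraph V) (H : PDAG V) : Prop where
  undir_iff : ∀ a b, H.undir a b ↔ (skel G).Adj a b ∧ ¬ H.dir a b ∧ ¬ H.dir b a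
  sound : ∀ G', IsDAG G' → SamePattern G G' → ∀ a b, H.dir a b → G'.Adj a b
  dir_of_vStruct : ∀ a b c, VStruct G a b c → H.dir a b
  reason : ∀ a b, H.dir a b →
    (∃ d, VStruct G a b d) ∨ (∃ d, H.dir d a ∧ ¬ (skel G).Adj d b) ∨
      (∃ d, H.dir a d ∧ H.dir d b) ∨
      ∃ d e, d ≠ e ∧ (skel G).Adj a d ∧ (skel G).Adj a e ∧ H.dir d b ∧ H.dir e b ∧
        ¬ (skel G).Adj d e ∧ ¬ (G.Adj d a ∧ G.Adj e a)

namespace MeekInv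

theorem dir_adj (hG : IsDAG G) (h : MeekInv G H) {a b : V} (hab : H.dir a b) : G.Adj a b :=
  h.sound G hG ⟨fun _ _ => Iff.rfl, fun _ _ _ => Iff.rfl⟩ a b hab

theorem adj_iff (hG : IsDAG G) (h : MeekInv G H) {a b : V} : H.Adj a b ↔ (skel G).Adj a b := by
  have h1 := h.undir_iff a b
  have h2 : H.dir a b → (skel G).Adj a b := fun h0 => hG.skel_adj.2 (.inl (h.dir_adj hG h0))
  have h3 : H.dir b a → (skel G).Adj a b := fun h0 => hG.skel_adj.2 (.inr (h.dir_adj hG h0))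
  rw [PDAG.Adj]
  tauto

/-- An application of a rule preserves the invariant; in particular, the rules are sound. -/
theorem orientEdge (hG : IsDAG G) (h : MeekInv G H) {a b : V} (hab : MeekApplies H a b) :
    MeekInv G (H.orientEdge a b) := by
  obtain ⟨hu, hr⟩ := hab
  simp only [h.adj_iff hG] at hr
  obtain ⟨hadj, hnab, hnba⟩ := (h.undir_iff a b).1 hu
  refine ⟨fun x y => ?_, fun G' hG' hp x y hxy => ?_,
    fun x y z hv => .inl (h.dir_of_vStruct x y z hv), fun x y hxy => ?_⟩
  · have := h.undir_iff x y
    simp only [PDAG.orientEdge]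
    tauto
  · rcases hxy with hxy | ⟨rfl, rfl⟩
    · exact h.sound G' hG' hp x y hxy
    have hs := h.sound G' hG' hp
    refine (hG'.skel_adj.1 ((hp.skel_adj _ _).1 hadj)).resolve_right fun hyx => ?_
    rcases hr with ⟨c, hcx, hcy⟩ | ⟨c, hxc, hcy⟩ | ⟨c, d, hcd, hxc, hxd, hcy, hdy, hncd⟩
    · have hne : c ≠ y := by
        rintro rfl
        exact hnba hcx
      have hv : VStruct G' c x y := ⟨hs _ _ hcx, hyx, hne, fun h0 => hcy ((hp.skel_adj _ _).2 h0)⟩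
      exact hnba (h.dir_of_vStruct _ _ _ ((hp.vStruct _ _ _).2 hv.symm))
    · exact hG'.no_triangle (hs _ _ hxc) (hs _ _ hcy) hyx
    · have hto : ∀ e, H.undir x e → H.dir e y → G'.Adj e x := fun e hxe hey =>
        (hG'.skel_adj.1 ((hp.skel_adj _ _).1 ((h.undir_iff _ _).1 hxe).1)).resolve_left
          fun h0 => hG'.no_triangle h0 (hs _ _ hey) hyx
      have hv : VStruct G' c x d := ⟨hto c hxc hcy, hto d hxd hdy, hcd,
        fun h0 => hncd ((hp.skel_adj _ _).2 h0)⟩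
      exact ((h.undir_iff _ _).1 hxc).2.2 (h.dir_of_vStruct _ _ _ ((hp.vStruct _ _ _).2 hv))
  · rcases hxy with hxy | ⟨rfl, rfl⟩
    · rcases h.reason x y hxy with h0 | ⟨d, h1, h2⟩ | ⟨d, h1, h2⟩ | ⟨d, e, h1, h2, h3, h4, h5, h6⟩
      · exact .inl h0
      · exact .inr (.inl ⟨d, .inl h1, h2⟩)
      · exact .inr (.inr (.inl ⟨d, .inl h1, .inl h2⟩))
      · exact .inr (.inr (.inr ⟨d, e, h1, h2, h3, .inl h4, .inl h5, h6⟩))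
    · rcases hr with ⟨c, hcx, hcy⟩ | ⟨c, hxc, hcy⟩ | ⟨c, d, hcd, hxc, hxd, hcy, hdy, hncd⟩
      · exact .inr (.inl ⟨c, .inl hcx, hcy⟩)
      · exact .inr (.inr (.inl ⟨c, .inl hxc, .inl hcy⟩))
      · refine .inr (.inr (.inr ⟨c, d, hcd, ((h.undir_iff _ _).1 hxc).1,
          ((h.undir_iff _ _).1 hxd).1, .inl hcy, .inl hdy, hncd, fun h0 => ?_⟩))
        have hv : VStruct G c x d := ⟨h0.1, h0.2, hcd, hncd⟩
        exact ((h.undir_iff _ _).1 hxc).2.2 (h.dir_of_vStruct _ _ _ hv)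

theorem reflTransGen (hG : IsDAG G) (h : MeekInv G H) {H' : PDAG V}
    (hH : Relation.ReflTransGen MeekStep H H') : MeekInv G H' := by
  induction hH with
  | refl => exact h
  | tail _ hs ih =>
    obtain ⟨a, b, hab, rfl⟩ := hs
    exact ih.orientEdge hG hab

/-- When no rule applies, a directed edge `a → b` and an undirected edge `b - c` always come with
`a → c`. Otherwise `a - c` is undirected; if `b` is the first vertex, in a topological order, for
which this happens, then none of the possible reasons for `a → b` is consistent with the rules. -/
theorem dir_of_dir_of_undir [Finite V] (hG : IsDAG G) (h : MeekInv G H)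
    (hcl : ∀ a b, ¬ MeekApplies H a b) {a b c : V} (hab : H.dir a b) (hbc : H.undir b c) :
    H.dir a c := by
  obtain ⟨f, hf⟩ := hG.exists_rank
  have hsymm := H.undir_symm
  have rule1 : ∀ {x y z}, H.dir x y → H.undir y z → (skel G).Adj x z := by
    intro x y z hxy hyz
    by_contra hxz
    exact hcl y z ⟨hyz, .inl ⟨x, hxy, fun h0 => hxz ((h.adj_iff hG).1 h0)⟩⟩
  have rule2 : ∀ {x y z}, H.undir x z → H.dir x y → H.dir y z → False :=
    fun hxz hxy hyz => hcl _ _ ⟨hxz, .inr (.inl ⟨_, hxy, hyz⟩)⟩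
  have rule3 : ∀ {x y z w}, H.undir x y → H.undir x z → H.undir x w → H.dir z y → H.dir w y →
      z ≠ w → (skel G).Adj z w := by
    intro x y z w hxy hxz hxw hzy hwy hne
    by_contra hzw
    exact hcl x y ⟨hxy, .inr (.inr ⟨z, w, hne, hxz, hxw, hzy, hwy,
      fun h0 => hzw ((h.adj_iff hG).1 h0)⟩)⟩
  have cases_adj : ∀ {x y}, (skel G).Adj x y → H.dir x y ∨ H.dir y x ∨ H.undir x y :=
    fun hxy => (h.adj_iff hG).2 hxy
  have weak : ∀ {x y z}, H.dir x y → H.undir y z → H.dir x z ∨ H.undir x z := by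
    intro x y z hxy hyz
    rcases cases_adj (rule1 hxy hyz) with h0 | h0 | h0
    · exact .inl h0
    · exact absurd hxy fun h1 => rule2 (hsymm _ _ hyz) h0 h1
    · exact .inr h0
  have excl : ∀ {x y}, H.undir x y → ¬ H.dir x y := fun h0 => ((h.undir_iff _ _).1 h0).2.1
  induction hn : f b using Nat.strong_induction_on generalizing a b c with
  | _ n ih =>
    refine (weak hab hbc).resolve_right fun hac => ?_
    have hca := hsymm _ _ hac
    have hcb := hsymm _ _ hbc
    have hlt : ∀ {x}, H.dir x b → f x < n := fun hx => hn ▸ hf _ _ (h.dir_adj hG hx)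
    rcases h.reason a b hab with ⟨d, hv⟩ | ⟨d, hda, hdb⟩ | ⟨d, had, hdb⟩ |
      ⟨d, e, hde, had, hae, hdb, heb, hnde, hne⟩
    · have hdb : H.dir d b := h.dir_of_vStruct _ _ _ hv.symm
      rcases weak hdb hbc with hdc | hdc
      · exact hv.2.2.2 (rule1 hdc hca).symm
      · exact hv.2.2.2 (rule3 hcb hca (hsymm _ _ hdc) hab hdb hv.2.2.1)
    · rcases weak hda hac with hdc | hdc
      · exact hdb (rule1 hdc hcb)
      · exact excl hdc (ih _ (hlt hab) hda hac rfl)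
    · rcases weak hdb hbc with hdc | hdc
      · exact rule2 hac had hdc
      · exact excl hac (ih _ (hlt hdb) had hdc rfl)
    · rcases weak hdb hbc with hdc | hdc <;> rcases weak heb hbc with hec | hec
      · rcases cases_adj had with had | hda | had
        · exact rule2 hac had hdc
        · rcases cases_adj hae with hae | hea | hae
          · exact rule2 hac hae hec
          · exact hne ⟨h.dir_adj hG hda, h.dir_adj hG hea⟩
          · exact hnde (rule1 hda hae)
        · rcases cases_adj hae with hae | hea | hae
          · exact rule2 hac hae hec
          · exact hnde (rule1 hea had).symm
          · exact hnde (rule3 hac had hae hdc hec hde)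
      · exact hnde (rule1 hdc (hsymm _ _ hec))
      · exact hnde (rule1 hec (hsymm _ _ hdc)).symm
      · exact hnde (rule3 hcb (hsymm _ _ hdc) (hsymm _ _ hec) hdb heb hde)

/-- When no rule applies, the undirected part is chordal: among any vertices, the last one in a
topological order of `G` is simplicial. -/
theorem exists_simplicial [Finite V] (hG : IsDAG G) (h : MeekInv G H)
    (hcl : ∀ a b, ¬ MeekApplies H a b) (W : Finset V) (hW : W.Nonempty) :
    ∃ s, Simplicial H.undir W s := by
  obtain ⟨f, hf⟩ := hG.exists_rank
  obtain ⟨s, hs, hmax⟩ := Finset.exists_max_image W f hW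
  have hto : ∀ x ∈ W, H.undir x s → G.Adj x s := fun x hx hxs =>
    (hG.skel_adj.1 ((h.undir_iff _ _).1 hxs).1).resolve_right fun h0 => by
      have := hf _ _ h0
      have := hmax x hx
      omega
  refine ⟨s, hs, fun x hx y hy hxs hys hxy => ?_⟩
  have hxs' := (h.undir_iff _ _).1 hxs
  have hys' := (h.undir_iff _ _).1 hys
  rw [h.undir_iff]
  refine ⟨?_, fun h0 => ?_, fun h0 => ?_⟩
  · by_contra hadj
    have hv : VStruct G x s y := ⟨hto x hx hxs, hto y hy hys, hxy, hadj⟩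
    exact hxs'.2.1 (h.dir_of_vStruct _ _ _ hv)
  · exact hxs'.2.1 (h.dir_of_dir_of_undir hG hcl h0 hys)
  · exact hys'.2.1 (h.dir_of_dir_of_undir hG hcl h0 hxs)

/-- The directed graph which results from `H` by directing the undirected edges along an order. -/
def extension (H : PDAG V) (f : V → ℕ) : Digraph V where
  Adj a b := H.dir a b ∨ (H.undir a b ∧ f a < f b)

/-- When no rule applies, ordering the undirected edges does not create cycles: a cycle would be
undirected, and then go against the order, or else its undirected edges could be skipped. -/
theorem extension_isDAG [Finite V] (hG : IsDAG G) (h : MeekInv G H)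
    (hcl : ∀ a b, ¬ MeekApplies H a b) (f : V → ℕ) : IsDAG (extension H f) := by
  have skip : ∀ {a b c}, Relation.TransGen H.dir a b → H.undir b c →
      Relation.TransGen H.dir a c := by
    intro a b c hab hbc
    rcases Relation.TransGen.tail'_iff.1 hab with ⟨e, hae, heb⟩
    exact .tail' hae (h.dir_of_dir_of_undir hG hcl heb hbc)
  have skips : ∀ {a b c}, Relation.TransGen H.dir a b → Relation.ReflTransGen H.undir b c →
      Relation.TransGen H.dir a c := by
    intro a b c hab hbc
    induction hbc with
    | refl => exact hab
    | tail _ h0 ih => exact skip ih h0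
  have key : ∀ a b, Relation.TransGen (extension H f).Adj a b →
      (f a < f b ∧ Relation.ReflTransGen H.undir a b) ∨
        ∃ c, Relation.ReflTransGen H.undir a c ∧ Relation.TransGen H.dir c b := by
    intro a b hab
    induction hab with
    | single h0 =>
      rcases h0 with h0 | h0
      · exact .inr ⟨a, .refl, .single h0⟩
      · exact .inl ⟨h0.2, .single h0.1⟩
    | tail _ h0 ih =>
      rcases h0 with h0 | h0 <;> rcases ih with ih | ⟨c, hac, hcb⟩
      · exact .inr ⟨_, ih.2, .single h0⟩
      · exact .inr ⟨c, hac, hcb.tail h0⟩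
      · exact .inl ⟨ih.1.trans h0.2, ih.2.tail h0.1⟩
      · exact .inr ⟨c, hac, skip hcb h0.1⟩
  intro v hv
  rcases key v v hv with h0 | ⟨c, hvc, hcv⟩
  · exact lt_irrefl _ h0.1
  · exact hG c (Relation.TransGen.mono (fun _ _ => h.dir_adj hG) _ _ (skips hcv hvc))

/-- When no rule applies, a perfect order of the undirected edges leads to a graph with the same
pattern as `G`. -/
theorem extension_samePattern [Finite V] (hG : IsDAG G) (h : MeekInv G H)
    (hcl : ∀ a b, ¬ MeekApplies H a b) {f : V → ℕ} (hinj : Function.Injective f)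
    (hf : ∀ z x y, H.undir x z → H.undir y z → f x < f z → f y < f z → x ≠ y → H.undir x y) :
    SamePattern G (extension H f) := by
  have hE := h.extension_isDAG hG hcl f
  have hskel : ∀ a b, (skel G).Adj a b ↔ (skel (extension H f)).Adj a b := by
    intro a b
    rw [hE.skel_adj, ← h.adj_iff hG]
    constructor
    · rintro (h0 | h0 | h0)
      · exact .inl (.inl h0)
      · exact .inr (.inl h0)
      · have hne : f a ≠ f b := fun he => ((h.undir_iff _ _).1 h0).1.ne (hinj he)
        rcases hne.lt_or_gt with hlt | hlt
        exacts [.inl (.inr ⟨h0, hlt⟩), .inr (.inr ⟨H.undir_symm _ _ h0, hlt⟩)]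
    · rintro ((h0 | h0) | (h0 | h0))
      exacts [.inl h0, .inr (.inr h0.1), .inr (.inl h0), .inr (.inr (H.undir_symm _ _ h0.1))]
  refine ⟨hskel, fun a b c => ⟨fun hv => ?_, fun hv => ?_⟩⟩
  · exact ⟨.inl (h.dir_of_vStruct _ _ _ hv), .inl (h.dir_of_vStruct _ _ _ hv.symm), hv.2.2.1,
      fun h0 => hv.2.2.2 ((hskel _ _).2 h0)⟩
  · obtain ⟨hab, hcb, hne, hac⟩ := hv
    rw [← hskel] at hac
    rcases hab with hab | hab <;> rcases hcb with hcb | hcb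
    · exact ⟨h.dir_adj hG hab, h.dir_adj hG hcb, hne, hac⟩
    · have := h.dir_of_dir_of_undir hG hcl hab (H.undir_symm _ _ hcb.1)
      exact absurd (hG.skel_adj.2 (.inl (h.dir_adj hG this))) hac
    · have := h.dir_of_dir_of_undir hG hcl hcb (H.undir_symm _ _ hab.1)
      exact absurd (hG.skel_adj.2 (.inr (h.dir_adj hG this))) hac
    · exact absurd ((h.undir_iff _ _).1 (hf b a c hab.1 hcb.1 hab.2 hcb.2 hne)).1 hac

/-- When no rule applies, all undirected edges at a vertex `r` can be directed away from it. -/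
theorem exists_mem_MEC [Fintype V] (hG : IsDAG G) (h : MeekInv G H)
    (hcl : ∀ a b, ¬ MeekApplies H a b) (r : V) :
    ∃ G' ∈ MEC G, ∀ b, H.undir r b → G'.Adj r b := by
  obtain ⟨f, hinj, hfirst, hperf⟩ := exists_perfect_order H.undir_symm
    (h.exists_simplicial hG hcl) r (Finset.mem_univ r)
  simp only [Finset.coe_univ, Set.injOn_univ, Finset.mem_univ, true_imp_iff] at hinj hfirst hperf
  refine ⟨extension H f, (mem_MEC_iff hG).2 ⟨h.extension_isDAG hG hcl f,
    h.extension_samePattern hG hcl hinj hperf⟩, fun b hb => .inr ⟨hb, hfirst b ?_⟩⟩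
  exact ((h.undir_iff _ _).1 hb).1.ne'

/-- Completeness of Meek's rules: when no rule applies, the CPDAG is reached. -/
theorem eq_cpdag [Fintype V] (hG : IsDAG G) (h : MeekInv G H)
    (hcl : ∀ a b, ¬ MeekApplies H a b) : H = cpdag G := by
  have hGG : G ∈ MEC G := ⟨hG, fun _ _ _ _ _ _ => Iff.rfl⟩
  have hsound : ∀ G' ∈ MEC G, ∀ a b, H.dir a b → G'.Adj a b := fun G' hG' =>
    h.sound G' hG'.1 ((mem_MEC_iff hG).1 hG').2
  ext a b
  · refine ⟨fun hab G' hG' => hsound G' hG' a b hab, fun hab => ?_⟩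
    rcases (h.adj_iff hG).2 (hG.skel_adj.2 (.inl (hab G hGG))) with h0 | h0 | h0
    · exact h0
    · exact absurd (hsound G hGG _ _ h0) (hG.asymm (hab G hGG))
    · obtain ⟨G', hG', hb⟩ := h.exists_mem_MEC hG hcl b
      exact absurd (hb a (H.undir_symm _ _ h0)) (hG'.1.asymm (hab G' hG'))
  · constructor
    · intro hab
      obtain ⟨G₁, h1, ha⟩ := h.exists_mem_MEC hG hcl a
      obtain ⟨G₂, h2, hb⟩ := h.exists_mem_MEC hG hcl b
      exact ⟨⟨G₁, h1, ha b hab⟩, ⟨G₂, h2, hb a (H.undir_symm _ _ hab)⟩⟩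
    · rintro ⟨⟨G₁, h1, hab⟩, ⟨G₂, h2, hba⟩⟩
      refine (h.undir_iff a b).2 ⟨?_, fun h0 => ?_, fun h0 => ?_⟩
      · exact (((mem_MEC_iff hG).1 h1).2.skel_adj _ _).2 (h1.1.skel_adj.2 (.inl hab))
      · exact h2.1.asymm hba (hsound G₂ h2 _ _ h0)
      · exact h1.1.asymm hab (hsound G₁ h1 _ _ h0)

end MeekInv

/-- Every application of a rule decreases the number of undirected edges. -/
theorem meekStep_wf [Finite V] : WellFounded fun H' H : PDAG V => MeekStep H H' := by
  refine Subrelation.wf (r := InvImage (· < ·) fun H : PDAG V =>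
    {p : V × V | H.undir p.1 p.2}.ncard) ?_ (InvImage.wf _ wellFounded_lt)
  rintro H' H ⟨a, b, hab, rfl⟩
  refine Set.ncard_lt_ncard ⟨fun p hp => hp.1, fun hsub => ?_⟩ (Set.toFinite _)
  exact (hsub (a := (a, b)) hab.1).2.1 ⟨rfl, rfl⟩

/-- From a graph with the invariant, the rules lead to the CPDAG and nowhere else. -/
theorem MeekInv.meekResult_iff [Fintype V] (hG : IsDAG G) (h : MeekInv G H) (H' : PDAG V) :
    MeekResult H H' ↔ H' = cpdag G := by
  have hres : ∀ H', MeekResult H H' → H' = cpdag G := fun H' hH' =>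
    (h.reflTransGen hG hH'.1).eq_cpdag hG fun a b hab => hH'.2 _ ⟨a, b, hab, rfl⟩
  refine ⟨hres H', ?_⟩
  rintro rfl
  obtain ⟨H₁, h1, hmin⟩ := meekStep_wf.has_min {H' | Relation.ReflTransGen MeekStep H H'}
    ⟨H, .refl⟩
  have hH₁ : MeekResult H H₁ := ⟨h1, fun H₂ h2 => hmin H₂ (h1.tail h2) h2⟩
  exact hres H₁ hH₁ ▸ hH₁

end Meek

/-! ### The adjacency search -/

section Oracle

variable {V : Type*} {G : Digraph V} {I : V → V → Finset V → ℝ} {α : ℝ}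

/-- The test `I` decides d-separation in `G`. -/
def IsDSepTest (G : Digraph V) (I : V → V → Finset V → ℝ) : Prop :=
  ∀ (i j : V) (S : Finset V), i ≠ j → i ∉ S → j ∉ S →
    (DSep G i j S → I i j S = 1) ∧ (¬ DSep G i j S → I i j S = 0)

theorem IsDSepTest.le_iff (hI : IsDSepTest G I) (hα₀ : 0 < α) (hα₁ : α ≤ 1) {i j : V}
    {S : Finset V} (hij : i ≠ j) (hi : i ∉ S) (hj : j ∉ S) : α ≤ I i j S ↔ DSep G i j S := by
  obtain ⟨h1, h0⟩ := hI i j S hij hi hj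
  by_cases hs : DSep G i j S
  · simpa [hs, h1 hs] using hα₁
  · simpa [hs, h0 hs] using hα₀

theorem pcStableLevel_antitone : Antitone (pcStableLevel I α) :=
  antitone_nat_of_succ_le fun _ _ _ h => h.1

/-- An edge of the skeleton is never removed. -/
theorem skel_le_pcStableLevel (hG : IsDAG G) (hI : IsDSepTest G I) (hα₀ : 0 < α) (hα₁ : α ≤ 1)
    (l : ℕ) : skel G ≤ pcStableLevel I α l := by
  have key : ∀ {l i k}, (skel G).Adj i k → ¬ Separated I α (pcStableLevel I α l) l i k := by
    rintro l i k hik ⟨S, -, hS, hle⟩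
    refine not_dSep_of_adj hG hik ((hI.le_iff hα₀ hα₁ hik.ne ?_ ?_).1 hle)
    · exact fun h0 => (hS i h0).1.ne rfl
    · exact fun h0 => (hS k h0).2 rfl
  induction l with
  | zero => exact le_top
  | succ l ih => exact fun i k hik => ⟨ih hik, key hik, key hik.symm⟩

/-- The adjacency search finds the skeleton: nonadjacent vertices are separated by a set of
neighbours of one of them, and these neighbours are still present when the search arrives at the
size of this set. -/
theorem pcStable_eq_skel [Fintype V] (hG : IsDAG G) (hI : IsDSepTest G I) (hα₀ : 0 < α)
    (hα₁ : α ≤ 1) : pcStable I α = skel G := by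
  have hle := skel_le_pcStableLevel hG hI hα₀ hα₁
  refine le_antisymm (fun i k hik => ?_) (hle _)
  by_contra hadj
  have hne : i ≠ k := hik.ne
  obtain ⟨S, hi, hk, hS, hnb⟩ := exists_dSep hG hne hadj
  have hik' : (pcStableLevel I α (S.card + 1)).Adj i k :=
    pcStableLevel_antitone (Nat.succ_le_of_lt (Finset.card_lt_univ_of_notMem hi)) hik
  rcases hnb with hnb | hnb
  · refine hik'.2.1 ⟨S, rfl, fun s hs => ⟨hle _ (hG.skel_adj.2 (.inr (hnb s hs))), ?_⟩,
      (hI.le_iff hα₀ hα₁ hne hi hk).2 hS⟩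
    rintro rfl
    exact hk hs
  · refine hik'.2.2 ⟨S, rfl, fun s hs => ⟨hle _ (hG.skel_adj.2 (.inr (hnb s hs))), ?_⟩,
      (hI.le_iff hα₀ hα₁ hne.symm hk hi).2 (hS.symm hG)⟩
    rintro rfl
    exact hi hs

/-! ### Shapley independence values of colliders -/

theorem shapleyWeight_pos (n s : ℕ) : 0 < shapleyWeight n s := by
  unfold shapleyWeight
  positivity

theorem IsDSepTest.nonneg (hI : IsDSepTest G I) {i j : V} {S : Finset V} (hij : i ≠ j)
    (hi : i ∉ S) (hj : j ∉ S) : 0 ≤ I i j S := by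
  obtain ⟨h1, h0⟩ := hI i j S hij hi hj
  by_cases hs : DSep G i j S
  · simp [h1 hs]
  · simp [h0 hs]

theorem mem_condSets [Fintype V] {C : SimpleGraph V} {i j k : V} {S : Finset V} :
    S ∈ condSets C i j k ↔ (∀ s ∈ S, C.Adj i s ∧ s ≠ j) ∨ (∀ s ∈ S, C.Adj k s ∧ s ≠ j) := by
  simp [condSets]

theorem notMem_of_mem_condSets [Fintype V] {C : SimpleGraph V} {i j k : V} {S : Finset V}
    (hik : ¬ C.Adj i k) (hS : S ∈ condSets C i j k) : i ∉ S ∧ j ∉ S ∧ k ∉ S := by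
  rcases mem_condSets.1 hS with h | h
  · exact ⟨fun h0 => (h i h0).1.ne rfl, fun h0 => (h j h0).2 rfl, fun h0 => hik (h k h0).1⟩
  · exact ⟨fun h0 => hik (h i h0).1.symm, fun h0 => (h j h0).2 rfl, fun h0 => (h k h0).1.ne rfl⟩

variable [Fintype V] {i j k : V}

/-- The value of a vertex that is not a collider between `i` and `k` is not negative, since such a
vertex belongs to all separating sets. -/
theorem siv_nonneg (hG : IsDAG G) (hI : IsDSepTest G I) (hut : IsUT (skel G) i j k)
    (hv : ¬ VStruct G i j k) : 0 ≤ siv I (skel G) j i k := by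
  classical
  obtain ⟨hik, hij, hjk, hadj⟩ := hut
  refine Finset.sum_nonneg fun S hS => mul_nonneg (shapleyWeight_pos _ _).le ?_
  obtain ⟨hi, hj, hk⟩ := notMem_of_mem_condSets hadj hS
  have hns : ¬ DSep G i k S := fun hs =>
    hj (mem_of_dSep_of_not_collider hG hij hjk (fun h0 => hv ⟨h0.1, h0.2, hik, hadj⟩) hs)
  rw [(hI i k S hik hi hk).2 hns, sub_zero]
  exact hI.nonneg hik (by simp [hi, hij.ne]) (by simp [hk, hjk.ne'])

/-- A collider between `i` and `k` belongs to no separating set, so its value is the negative of the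
total weight of the separating sets among the conditioning sets. -/
theorem siv_collider (hG : IsDAG G) (hI : IsDSepTest G I) (hv : VStruct G i j k) :
    siv I (skel G) j i k = -∑ S ∈ condSets (skel G) i j k,
      shapleyWeight (numPlayers (skel G) i k) S.card * I i k S := by
  classical
  obtain ⟨hij, hkj, hik, hadj⟩ := hv
  rw [siv, ← Finset.sum_neg_distrib]
  refine Finset.sum_congr rfl fun S hS => ?_
  obtain ⟨hi, hj, hk⟩ := notMem_of_mem_condSets hadj hS
  rw [(hI i k (insert j S) hik (by simp [hi, hG.ne hij]) (by simp [hk, hG.ne hkj])).2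
    (not_dSep_of_collider hG hij hkj (by simp))]
  ring

theorem siv_collider_neg (hG : IsDAG G) (hI : IsDSepTest G I) (hv : VStruct G i j k) :
    siv I (skel G) j i k < 0 := by
  classical
  rw [siv_collider hG hI hv, neg_lt_zero]
  obtain ⟨hij, hkj, hik, hadj⟩ := hv
  obtain ⟨S, hi, hk, hS, hnb⟩ := exists_dSep hG hik hadj
  have hj : ∀ s ∈ S, s ≠ j := by
    rintro s hs rfl
    exact not_dSep_of_collider hG hij hkj hs hS
  refine Finset.sum_pos' (fun T hT => mul_nonneg (shapleyWeight_pos _ _).le ?_) ⟨S, ?_, ?_⟩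
  · obtain ⟨hi, -, hk⟩ := notMem_of_mem_condSets hadj hT
    exact hI.nonneg hik hi hk
  · exact mem_condSets.2 (hnb.imp
      (fun h s hs => ⟨hG.skel_adj.2 (.inr (h s hs)), hj s hs⟩)
      (fun h s hs => ⟨hG.skel_adj.2 (.inr (h s hs)), hj s hs⟩))
  · rw [(hI i k S hik hi hk).1 hS, mul_one]
    exact shapleyWeight_pos _ _

/-- The value of any player is at least the negative of the total weight of the separating sets
which do not contain it, and no separating set contains a collider. -/
theorem siv_collider_le (hG : IsDAG G) (hI : IsDSepTest G I) (hv : VStruct G i j k) {c : V}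
    (hc : (skel G).Adj i c ∨ (skel G).Adj k c) :
    siv I (skel G) j i k ≤ siv I (skel G) c i k := by
  classical
  rw [siv_collider hG hI hv]
  obtain ⟨hij, hkj, hik, hadj⟩ := hv
  set w := fun S : Finset V => shapleyWeight (numPlayers (skel G) i k) S.card with hw
  have hci : i ≠ c := by
    rintro rfl
    exact hc.elim (fun h => h.ne rfl) fun h => hadj h.symm
  have hck : k ≠ c := by
    rintro rfl
    exact hc.elim hadj fun h => h.ne rfl
  have h1 : ∑ S ∈ condSets (skel G) i c k, w S * I i k S ≤
      ∑ S ∈ condSets (skel G) i j k, w S * I i k S := by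
    have hzero : ∀ S ∈ condSets (skel G) i c k, S ∉ condSets (skel G) i j k →
        w S * I i k S = 0 := by
      intro S hS hS'
      obtain ⟨hi, -, hk⟩ := notMem_of_mem_condSets hadj hS
      have hj : j ∈ S := by
        by_contra hj
        have hne : ∀ s ∈ S, s ≠ j := by
          rintro s hs rfl
          exact hj hs
        exact hS' (mem_condSets.2 ((mem_condSets.1 hS).imp
          (fun h s hs => ⟨(h s hs).1, hne s hs⟩) (fun h s hs => ⟨(h s hs).1, hne s hs⟩)))
      rw [(hI i k S hik hi hk).2 (not_dSep_of_collider hG hij hkj hj), mul_zero]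
    rw [← Finset.sum_subset (Finset.inter_subset_left
      (s₁ := condSets (skel G) i c k) (s₂ := condSets (skel G) i j k))
      fun S hS hS' => hzero S hS fun h => hS' (Finset.mem_inter.2 ⟨hS, h⟩)]
    refine Finset.sum_le_sum_of_subset_of_nonneg Finset.inter_subset_right fun S hS _ => ?_
    obtain ⟨hi, -, hk⟩ := notMem_of_mem_condSets hadj hS
    exact mul_nonneg (shapleyWeight_pos _ _).le (hI.nonneg hik hi hk)
  have h2 : -∑ S ∈ condSets (skel G) i c k, w S * I i k S ≤ siv I (skel G) c i k := by
    rw [siv, ← Finset.sum_neg_distrib]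
    refine Finset.sum_le_sum fun S hS => ?_
    obtain ⟨hi, -, hk⟩ := notMem_of_mem_condSets hadj hS
    have h3 := mul_nonneg (shapleyWeight_pos (numPlayers (skel G) i k) S.card).le
      (hI.nonneg hik (S := insert c S) (by simp [hi, hci]) (by simp [hk, hck]))
    rw [mul_sub]
    simp only [hw]
    linarith
  linarith

/-- The decision rule recognizes exactly the v-structures. -/
theorem declaredCollider_iff (hG : IsDAG G) (hI : IsDSepTest G I) (hut : IsUT (skel G) i j k) :
    DeclaredCollider I (skel G) i j k ↔ VStruct G i j k := by
  constructor
  · intro h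
    by_contra hv
    exact absurd h.2 (siv_nonneg hG hI hut hv).not_gt
  · intro hv
    refine ⟨⟨⟨j, .inl hut.2.1, rfl⟩, ?_⟩, siv_collider_neg hG hI hv⟩
    rintro _ ⟨c, hc, rfl⟩
    exact siv_collider_le hG hI hv hc

/-! ### The pattern -/

/-- While the unshielded triples are processed, the directed edges are those of the v-structures
processed so far. The conditions for orienting a triple never prevent this, because all directed
edges belong to `G`. -/
theorem foldl_vStep (hG : IsDAG G) (hI : IsDSepTest G I) : ∀ (L : List (V × V × V)) (H : PDAG V),
    (∀ t ∈ L, IsUT (skel G) t.1 t.2.1 t.2.2) →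
    (∀ a b, H.undir a b ↔ (skel G).Adj a b ∧ ¬ H.dir a b ∧ ¬ H.dir b a) →
    (∀ a b, H.dir a b → ∃ c, VStruct G a b c) →
    (∀ a b, (L.foldl (vStep I (skel G)) H).undir a b ↔ (skel G).Adj a b ∧
      ¬ (L.foldl (vStep I (skel G)) H).dir a b ∧ ¬ (L.foldl (vStep I (skel G)) H).dir b a) ∧
    (∀ a b, (L.foldl (vStep I (skel G)) H).dir a b → ∃ c, VStruct G a b c) ∧
    (∀ a b, H.dir a b → (L.foldl (vStep I (skel G)) H).dir a b) ∧
    ∀ a b c, VStruct G a b c → (a, b, c) ∈ L →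
      (L.foldl (vStep I (skel G)) H).dir a b ∧ (L.foldl (vStep I (skel G)) H).dir c b
  | [], H, _, hu, hd => ⟨hu, hd, fun _ _ h => h, fun _ _ _ _ h => absurd h List.not_mem_nil⟩
  | (i, j, k) :: L, H, hL, hu, hd => by
    have hdec := declaredCollider_iff hG hI (hL (i, j, k) List.mem_cons_self)
    have hdG : ∀ a b, H.dir a b → G.Adj a b := fun a b h0 => (hd a b h0).choose_spec.1
    -- one step of the loop
    have hstep : (∀ a b, (vStep I (skel G) H (i, j, k)).undir a b ↔ (skel G).Adj a b ∧
          ¬ (vStep I (skel G) H (i, j, k)).dir a b ∧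
          ¬ (vStep I (skel G) H (i, j, k)).dir b a) ∧
        (∀ a b, (vStep I (skel G) H (i, j, k)).dir a b → ∃ c, VStruct G a b c) ∧
        (∀ a b, H.dir a b → (vStep I (skel G) H (i, j, k)).dir a b) ∧
        (VStruct G i j k → (vStep I (skel G) H (i, j, k)).dir i j ∧
          (vStep I (skel G) H (i, j, k)).dir k j) := by
      by_cases hcond : DeclaredCollider I (skel G) i j k ∧ Orientable H i j k
      · have hv := hdec.1 hcond.1
        rw [vStep, if_pos hcond]
        refine ⟨fun a b => ?_, fun a b hab => ?_, fun a b hab => .inl (.inl hab),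
          fun _ => ⟨.inl (.inr ⟨rfl, rfl⟩), .inr ⟨rfl, rfl⟩⟩⟩
        · have := hu a b
          simp only [PDAG.orientV, PDAG.orientEdge]
          tauto
        · rcases hab with (hab | ⟨rfl, rfl⟩) | ⟨rfl, rfl⟩
          exacts [hd a b hab, ⟨k, hv⟩, ⟨i, hv.symm⟩]
      · rw [vStep, if_neg hcond]
        refine ⟨hu, hd, fun _ _ h => h, fun hv => ?_⟩
        have hij : ¬ H.dir j i := fun h0 => hG.asymm hv.1 (hdG _ _ h0)
        have hkj : ¬ H.dir j k := fun h0 => hG.asymm hv.2.1 (hdG _ _ h0)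
        have hcyc : (H.orientV i j k).NoDirCycle := by
          refine fun v h0 => hG v (Relation.TransGen.mono ?_ _ _ h0)
          rintro a b ((hab | ⟨rfl, rfl⟩) | ⟨rfl, rfl⟩)
          exacts [hdG a b hab, hv.1, hv.2.1]
        by_contra hnd
        refine hcond ⟨hdec.2 hv, fun h0 => hnd ?_, hij, hkj, hcyc⟩
        exact ⟨h0.1.resolve_right hij, h0.2.resolve_right hkj⟩
    obtain ⟨h1, h2, h3, h4⟩ := hstep
    obtain ⟨g1, g2, g3, g4⟩ := foldl_vStep hG hI L _
      (fun t ht => hL t (List.mem_cons_of_mem _ ht)) h1 h2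
    rw [List.foldl_cons]
    refine ⟨g1, g2, fun a b hab => g3 a b (h3 a b hab), fun a b c hv hmem => ?_⟩
    rcases List.mem_cons.1 hmem with h0 | h0
    · obtain ⟨rfl, rfl, rfl⟩ : a = i ∧ b = j ∧ c = k := by simpa using h0
      exact ⟨g3 _ _ (h4 hv).1, g3 _ _ (h4 hv).2⟩
    · exact g4 a b c hv h0

/-- The first two steps of the algorithm produce the pattern of `G`. -/
theorem meekInv_afterStep2 (hG : IsDAG G) (hI : IsDSepTest G I) (hα₀ : 0 < α) (hα₁ : α ≤ 1)
    {L : List (V × V × V)} (hL : ListsUTs (pcStable I α) L) : MeekInv G (afterStep2 I α L) := by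
  have hC := pcStable_eq_skel hG hI hα₀ hα₁
  rw [hC] at hL
  rw [afterStep2, hC, orientVStructures]
  obtain ⟨h1, h2, -, h4⟩ := foldl_vStep hG hI L (PDAG.ofSkeleton (skel G)) hL.1
    (fun a b => by simp [PDAG.ofSkeleton]) (fun a b h => h.elim)
  refine ⟨h1, fun G' _ hp a b hab => ?_, fun a b c hv => ?_, fun a b hab => .inl (h2 a b hab)⟩
  · obtain ⟨c, hv⟩ := h2 a b hab
    exact ((hp.vStruct _ _ _).1 hv).1
  · have hut : IsUT (skel G) a b c := ⟨hv.2.2.1, hG.skel_adj.2 (.inl hv.1),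
      hG.skel_adj.2 (.inr hv.2.1), hv.2.2.2⟩
    rcases hL.2 a b c hut with hmem | hmem
    exacts [(h4 a b c hv hmem).1, (h4 c b a hv.symm hmem).2]

end Oracle

end ShapleyPC

theorem theorem2 {V : Type*} [Fintype V] {E : V → Type*} [∀ v, MeasurableSpace (E v)]
    [∀ v, StandardBorelSpace (E v)] (P : MeasureTheory.Measure (∀ v, E v))
    [MeasureTheory.IsProbabilityMeasure P]
    (G : Digraph V) (hG : ShapleyPC.IsDAG G) (hP : ShapleyPC.Faithful P G)
    (I : V → V → Finset V → ℝ) (hI : ShapleyPC.IsPerfectCIT P I)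
    (α : ℝ) (hα₀ : 0 < α) (hα₁ : α ≤ 1)
    (L : List (V × V × V)) (hL : ShapleyPC.ListsUTs (ShapleyPC.pcStable I α) L) :
    -- Step 3 has no infinite run, whatever the order in which the rules are applied,
    Acc (fun H' H => ShapleyPC.MeekStep H H') (ShapleyPC.afterStep2 I α L) ∧
      -- and the outputs of the algorithm are exactly the CPDAG of `G`.
      ∀ H, ShapleyPC.IsOutput I α L H ↔ H = ShapleyPC.cpdag G := by
  have hI' : ShapleyPC.IsDSepTest G I := by
    intro i j S hij hi hj
    rw [← hP i j S hij hi hj]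
    exact hI i j S hij hi hj
  exact ⟨ShapleyPC.meekStep_wf.apply _, fun H =>
    (ShapleyPC.meekInv_afterStep2 hG hI' hα₀ hα₁ hL).meekResult_iff hG H⟩
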